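/- Let $B$ be a standard real Brownian motion with $B_0=0$ on a probability space $(\Omega,\mathcal F,P)$. For $x\ge 0$ let $X_t(x)=x+B_t+L_t(x)$ be the Skorohod reflected Brownian motion on $[0,\infty)$: almost surely, for every $x\ge0$, the path $t\mapsto L_t(x)$ is continuous and nondecreasing, $L_0(x)=0$, $X_t(x)\ge 0$ and $\int_0^t \mathbf 1_{\{0\}}(X_s(x))\,dL_s(x)=L_t(x)$ for all $t\ge 0$. Let $\tau(x)=\inf\{t>0: X_t(x)=0\}$, and for $a>0$, $x>0$ let $u^a(x)=P(\tau(x)>a)$. Let $X^a_t(x)$, $a>0$, $x>0$, $t\ge 0$, be the $(0,\infty)$-valued continuous solution flow of $$X^a_t(x)=x+B_t+\int_0^t \partial_x\ln u^a\,(X^a_s(x))\,ds$$ (almost surely, the equation holds for all $a,x>0$ and $t\ge0$), and let $V^a_t(x)=\partial_xX^a_t(x)$. 1. Almost surely the following hold. The derivative $V^a_t(x)$ exists for all $a,x>0$ and $t\ge0$. For all $a,t>0$, $x\mapsto V^a_t(x)$ is strictly increasing on $(0,\infty)$; for all $a,x>0$, $t\mapsto V^a_t(x)$ is strictly decreasing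 on $[0,\infty)$. For all $0<x<y$, $\tau(y)<\infty$ and $\lim_{a\downarrow0}V^a_{\tau(y)}(x)=0$, where $V^a_{\tau(y)}(x)$ means $\partial_xX^a_s(x)|_{s=\tau(y)}$. 2. For every $x>0$, almost surely, for all $t\ge0$ with $t\ne\tau(x)$, the derivative $\partial_xX_t(x)$ exists, equals $1$ if $t<\tau(x)$ and $0$ if $t>\tau(x)$, and $$\lim_{a\downarrow0}V^a_t(x)=\partial_xX_t(x).$$ Moreover, almost surely, the same holds simultaneously for all $x>0$ outside an at most countable ($\omega$-dependent) set and all $t\ne\tau(x)$; and almost surely $\lim_{a\downarrow0}V^a_t(x)=\partial_xX_t(x)$ for all $x>0$ and $t\ge0$ at which $\partial_xX_t(x)$ exists. Furthermore, for all $x,T>0$, the difference $V^a_t(x)-\partial_xX_t(x)$ is integrable over $(0,T]\times\Omega$ with respect to $dt\otimes P$ for every $a>0$, and $$\lim_{a\downarrow0}E\int_0^T\left|V^a_t(x)-\partial_xX_t(x)\right|dt=0.$$ -/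

import Mathlib

open MeasureTheory ProbabilityTheory Filter Set Topology
open scoped NNReal ENNReal

noncomputable section

/-- A continuous nondecreasing path `h` on `[0, ∞)`, extended by the constant `h 0` to the negative
half line, as a Stieltjes function; its measure is the Lebesgue-Stieltjes measure `dh`. -/
def pathStieltjes (h : ℝ≥0 → ℝ) (hc : Continuous h) (hm : Monotone h) : StieltjesFunction ℝ where
  toFun t := h t.toNNReal
  mono' := fun _ _ hst => hm (Real.toNNReal_le_toNNReal hst)
  right_continuous' := fun _ => (hc.comp continuous_real_toNNReal).continuousAt.continuousWithinAt

/-- `(g, h)` solves the Skorohod problem associated with the starting point `x` and the driving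
path `f`: `h` is continuous, nondecreasing, `h 0 = 0`, `g = x + f + h` is nonnegative and
`∫₀ᵗ 1_{0}(g(s)) dh(s) = h(t)` for every `t`. -/
structure IsSkorohodSolution (x : ℝ) (f g h : ℝ≥0 → ℝ) : Prop where
  continuous : Continuous h
  monotone : Monotone h
  zero : h 0 = 0
  eq : ∀ t, g t = x + f t + h t
  nonneg : ∀ t, 0 ≤ g t
  flat : ∀ t : ℝ≥0,
    ∫ s in Ioc (0 : ℝ) t, indicator {r : ℝ | g r.toNNReal = 0} (fun _ => (1 : ℝ)) s
      ∂(pathStieltjes h continuous monotone).measure = h t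

/-- `inf {t > 0 : g t = 0}`, with value `∞` if there is no such `t`. -/
def firstZero (g : ℝ≥0 → ℝ) : ℝ≥0∞ :=
  ⨅ (t : ℝ≥0) (_ : 0 < t ∧ g t = 0), (t : ℝ≥0∞)

/-- `u^a(x) = P(τ(x) > a)`, where `τ(x)` is the first zero of the process `X x`. -/
def survivalProb {Ω : Type*} [MeasurableSpace Ω] (P : Measure Ω) (X : ℝ → ℝ≥0 → Ω → ℝ)
    (a x : ℝ) : ℝ :=
  P.real {ω | ENNReal.ofReal a < firstZero (fun t => X x t ω)}

/-- The drift `∂ₓ ln u^a(x)`. -/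
def logDrift {Ω : Type*} [MeasurableSpace Ω] (P : Measure Ω) (X : ℝ → ℝ≥0 → Ω → ℝ)
    (a x : ℝ) : ℝ :=
  deriv (fun z => Real.log (survivalProb P X a z)) x

/-- `y` is a (global) solution on the open half line `(0, ∞)` of
`y(t) = x + f(t) + ∫₀ᵗ b(y(s)) ds`. -/
structure IsDriftSolution (b : ℝ → ℝ) (x : ℝ) (f y : ℝ≥0 → ℝ) : Prop where
  continuous : Continuous y
  pos : ∀ t, 0 < y t
  integrable : ∀ t : ℝ≥0, IntervalIntegrable (fun s : ℝ => b (y s.toNNReal)) volume 0 t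
  eq : ∀ t : ℝ≥0, y t = x + f t + ∫ s in (0 : ℝ)..t, b (y s.toNNReal)

/-- The spatial derivative `∂ₓ Xₜ(x)` of a family of processes indexed by the starting point. -/
def spatialDeriv {Ω : Type*} (X : ℝ → ℝ≥0 → Ω → ℝ) (x : ℝ) (t : ℝ≥0) (ω : Ω) : ℝ :=
  deriv (fun z => X z t ω) x

end

/-! Write M_t for the running maximum of -B on [0,t]. Skorohod's formula X_t(x) = B_t + max(x, M_t)
(`eq_add_max`) makes the reflected flow explicit: τ(x) > t exactly when M_t < x, and ∂ₓX_t(x) is 1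
for x > M_t, is 0 for x < M_t, and does not exist at x = M_t. By the reflection principle
(`measureReal_runningMax_lt`), u^a(x) = P(M_a < x) is a constant times the integral of exp(-z²/(2a))
over [0,x]. The drift is thus the Gaussian density divided by its primitive, `gaussDrift a⁻¹`. It is
positive, strictly decreasing and, by a Mills ratio inequality, strictly convex; it tends to 0
pointwise as a ↓ 0. Nothing else about it is used.

Convexity drives the flow. Let V_t(x) = exp ∫₀ᵗ b'(Y_s(x)) ds. Comparing b with its tangent gives (z
- x) V_t(x) ≤ Y_t(z) - Y_t(x) for all x, z > 0 (`flowDeriv_mul_le_sub`). Exchanging x and z traps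
the difference quotient between V_t(x) and V_t(z), so V is the derivative. Its monotonicity in t and
x is that of the exponent.

If M_t < x, then up to time t the path Y(x) ≥ x + B stays above m = x - M_t, and 1 ≥ V_t(x) ≥ exp(t
b'(m)) → 1, since convexity bounds -b'(m) by b(m/2). If x < z, then at t = τ(z) one has (z - x)
V_t(x) ≤ Y_t(z) ≤ X_t(z) + ε + t b(ε) = ε + t b(ε), which is arbitrarily small. If x < M_t, a level
z between them has τ(z) ≤ t, and V decreases in time.

All this is pathwise. Probability is needed for the law of M_t, which has no atom at a level x > 0
(for t > 0), and for the unboundedness of M. The L¹ statement follows by dominated convergence,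
since the difference of derivatives is at most 1 in absolute value. -/

/-! ### Convex drifts. -/

/-- `b` is a positive, strictly decreasing, strictly convex function on `(0, ∞)` with continuous
derivative `b'`. -/
structure IsConvexDrift (b b' : ℝ → ℝ) : Prop where
  hasDerivAt : ∀ x, 0 < x → HasDerivAt b (b' x) x
  pos : ∀ x, 0 < x → 0 < b x
  neg : ∀ x, 0 < x → b' x < 0
  continuousOn_deriv : ContinuousOn b' (Ioi 0)
  strictMonoOn : StrictMonoOn b' (Ioi 0)

namespace IsConvexDrift

variable {b b' : ℝ → ℝ}

lemma continuousOn (hb : IsConvexDrift b b') : ContinuousOn b (Ioi 0) :=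
  fun x hx => (hb.hasDerivAt x hx).continuousAt.continuousWithinAt

lemma exists_slope (hb : IsConvexDrift b b') {u v : ℝ} (hu : 0 < u) (huv : u < v) :
    ∃ w ∈ Ioo u v, b' w * (v - u) = b v - b u := by
  obtain ⟨w, hw, h⟩ := exists_hasDerivAt_eq_slope b b' huv
    (hb.continuousOn.mono fun z hz => hu.trans_le hz.1)
    (fun z hz => hb.hasDerivAt z (hu.trans hz.1))
  exact ⟨w, hw, by rw [h, div_mul_cancel₀ _ (sub_pos.2 huv).ne']⟩

/-- A convex drift lies above its tangents. -/
lemma tangent_le (hb : IsConvexDrift b b') {u v : ℝ} (hu : 0 < u) (hv : 0 < v) :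
    b u + b' u * (v - u) ≤ b v := by
  rcases lt_trichotomy u v with h | rfl | h
  · obtain ⟨w, hw, e⟩ := hb.exists_slope hu h
    have := hb.strictMonoOn hu (hu.trans hw.1) hw.1
    nlinarith [sub_pos.2 h]
  · simp
  · obtain ⟨w, hw, e⟩ := hb.exists_slope hv h
    have := hb.strictMonoOn (hv.trans hw.1) hu hw.2
    nlinarith [sub_pos.2 h]

lemma antitoneOn (hb : IsConvexDrift b b') {u v : ℝ} (hu : 0 < u) (huv : u ≤ v) : b v ≤ b u := by
  have := hb.tangent_le (hu.trans_le huv) hu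
  nlinarith [hb.neg v (hu.trans_le huv)]

/-- The derivative of a convex drift is controlled by the drift itself. -/
lemma neg_deriv_le (hb : IsConvexDrift b b') {m : ℝ} (hm : 0 < m) :
    -b' m ≤ 2 / m * b (m / 2) := by
  -- The tangent at m is evaluated at m/2, and b(m) > 0 is dropped.
  have h := hb.tangent_le hm (half_pos hm)
  have := hb.pos m hm
  rw [div_mul_eq_mul_div, le_div_iff₀ hm]
  nlinarith

end IsConvexDrift

/-! ### The Gaussian logarithmic derivative as a convex drift. -/

/-- The unnormalised Gaussian density of precision `c`. -/
noncomputable def gaussBump (c x : ℝ) : ℝ := Real.exp (-(c * x ^ 2 / 2))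

/-- The primitive of `gaussBump c` that vanishes at `0`. -/
noncomputable def gaussPrimitive (c x : ℝ) : ℝ := ∫ z in (0 : ℝ)..x, gaussBump c z

/-- The logarithmic derivative of `gaussPrimitive c`. -/
noncomputable def gaussDrift (c x : ℝ) : ℝ := gaussBump c x / gaussPrimitive c x

lemma gaussBump_pos (c x : ℝ) : 0 < gaussBump c x := Real.exp_pos _

lemma continuous_gaussBump (c : ℝ) : Continuous (gaussBump c) := by
  unfold gaussBump; fun_prop

lemma hasDerivAt_gaussBump (c x : ℝ) : HasDerivAt (gaussBump c) (-(c * x * gaussBump c x)) x := by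
  have h : HasDerivAt (fun y : ℝ => -(c * y ^ 2 / 2)) (-(c * x)) x := by
    refine (((hasDerivAt_pow 2 x).const_mul c).div_const 2).neg.congr_deriv ?_
    simp
    ring
  refine h.exp.congr_deriv ?_
  unfold gaussBump
  ring

lemma hasDerivAt_gaussPrimitive (c x : ℝ) :
    HasDerivAt (gaussPrimitive c) (gaussBump c x) x :=
  (continuous_gaussBump c).integral_hasStrictDerivAt 0 x |>.hasDerivAt

lemma gaussBump_anti {c : ℝ} (hc : 0 < c) {x y : ℝ} (hx : 0 ≤ x) (hxy : x ≤ y) :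
    gaussBump c y ≤ gaussBump c x := by
  unfold gaussBump
  gcongr

lemma mul_gaussBump_le_gaussPrimitive {c : ℝ} (hc : 0 < c) {x : ℝ} (hx : 0 ≤ x) :
    x * gaussBump c x ≤ gaussPrimitive c x := by
  have := intervalIntegral.integral_mono_on (μ := volume) hx
    (intervalIntegrable_const (c := gaussBump c x))
    ((continuous_gaussBump c).intervalIntegrable 0 x)
    (fun z hz => gaussBump_anti hc hz.1 hz.2)
  simpa [gaussPrimitive] using this

lemma gaussPrimitive_pos {c : ℝ} (hc : 0 < c) {x : ℝ} (hx : 0 < x) : 0 < gaussPrimitive c x :=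
  (mul_pos hx (gaussBump_pos c x)).trans_le (mul_gaussBump_le_gaussPrimitive hc hx.le)

lemma gaussPrimitive_mono {c : ℝ} : Monotone (gaussPrimitive c) :=
  monotone_of_hasDerivAt_nonneg (hasDerivAt_gaussPrimitive c) fun x => (gaussBump_pos c x).le

lemma gaussDrift_pos {c : ℝ} (hc : 0 < c) {x : ℝ} (hx : 0 < x) : 0 < gaussDrift c x :=
  div_pos (gaussBump_pos c x) (gaussPrimitive_pos hc hx)

lemma hasDerivAt_gaussDrift {c : ℝ} (hc : 0 < c) {x : ℝ} (hx : 0 < x) :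
    HasDerivAt (gaussDrift c) (-(gaussDrift c x * (c * x + gaussDrift c x))) x := by
  have hE := (gaussPrimitive_pos hc hx).ne'
  refine ((hasDerivAt_gaussBump c x).div (hasDerivAt_gaussPrimitive c x) hE).congr_deriv ?_
  unfold gaussDrift
  field_simp
  ring

/-- A Mills ratio type inequality: it expresses the convexity of `gaussDrift c`. -/
lemma gaussPrimitive_sq_lt {c : ℝ} (hc : 0 < c) {x : ℝ} (hx : 0 ≤ x) :
    c * gaussPrimitive c x ^ 2 < (c * x * gaussPrimitive c x + gaussBump c x) *
      (c * x * gaussPrimitive c x + 2 * gaussBump c x) := by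
  -- G is the difference of the two sides. It equals 2 at 0 and is nondecreasing on [0,∞): writing
  -- the primitive as x times the bump plus d ≥ 0 leaves only nonnegative terms in G'.
  set G : ℝ → ℝ := fun x => (c * x * gaussPrimitive c x + gaussBump c x) *
      (c * x * gaussPrimitive c x + 2 * gaussBump c x) - c * gaussPrimitive c x ^ 2 with hG
  have hd : ∀ x, HasDerivAt G (c * (2 * c * x * gaussPrimitive c x ^ 2 +
      gaussPrimitive c x * gaussBump c x * (1 - c * x ^ 2) - x * gaussBump c x ^ 2)) x := by
    intro x
    have he := hasDerivAt_gaussBump c x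
    have hE := hasDerivAt_gaussPrimitive c x
    have h1 : HasDerivAt (fun x => c * x * gaussPrimitive c x)
      (c * gaussPrimitive c x + c * x * gaussBump c x) x := by
      refine (((hasDerivAt_id x).const_mul c).mul hE).congr_deriv ?_
      simp
    refine (((h1.add he).mul (h1.add (he.const_mul 2))).sub
      ((hE.pow 2).const_mul c)).congr_deriv ?_
    simp
    ring
  have hmono : MonotoneOn G (Ici 0) := by
    refine monotoneOn_of_deriv_nonneg (convex_Ici 0)
      (fun x _ => (hd x).continuousAt.continuousWithinAt)
      (fun x _ => (hd x).differentiableAt.differentiableWithinAt) fun x hx => ?_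
    rw [interior_Ici] at hx
    rw [(hd x).deriv]
    have hx0 : (0 : ℝ) < x := hx
    obtain ⟨d, hd0, hdE⟩ : ∃ d, 0 ≤ d ∧ gaussPrimitive c x = x * gaussBump c x + d :=
      ⟨_, sub_nonneg.2 (mul_gaussBump_le_gaussPrimitive hc hx0.le), by ring⟩
    have he := gaussBump_pos c x
    rw [hdE]
    have : 0 ≤ c * (c * x ^ 3 * gaussBump c x ^ 2 + 3 * c * x ^ 2 * gaussBump c x * d +
      2 * c * x * d ^ 2 + d * gaussBump c x) := by positivity
    convert this using 1
    ring
  have h0 : G 0 = 2 := by simp [hG, gaussPrimitive, gaussBump]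
  have := hmono (self_mem_Ici) hx hx
  rw [h0] at this
  simp only [hG] at this
  linarith

/-- The derivative of `gaussDrift c`. -/
noncomputable def gaussDriftDeriv (c x : ℝ) : ℝ := -(gaussDrift c x * (c * x + gaussDrift c x))

lemma isConvexDrift_gaussDrift {c : ℝ} (hc : 0 < c) :
    IsConvexDrift (gaussDrift c) (gaussDriftDeriv c) := by
  have hd : ∀ x : ℝ, 0 < x → HasDerivAt (gaussDriftDeriv c)
      (gaussDrift c x * ((c * x + gaussDrift c x) * (c * x + 2 * gaussDrift c x) - c)) x := by
    intro x hx
    have hb := hasDerivAt_gaussDrift hc hx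
    refine (hb.mul (((hasDerivAt_id x).const_mul c).add hb)).neg.congr_deriv ?_
    simp
    ring
  have hcont : ContinuousOn (gaussDriftDeriv c) (Ioi 0) :=
    fun x hx => (hd x hx).continuousAt.continuousWithinAt
  refine ⟨fun x hx => hasDerivAt_gaussDrift hc hx, fun x hx => gaussDrift_pos hc hx,
    fun x hx => ?_, hcont, ?_⟩
  · have := gaussDrift_pos hc hx
    have : 0 < gaussDrift c x * (c * x + gaussDrift c x) := by positivity
    exact neg_neg_of_pos this
  · refine strictMonoOn_of_deriv_pos (convex_Ioi 0) hcont fun x hx => ?_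
    rw [interior_Ioi] at hx
    rw [(hd x hx).deriv]
    refine mul_pos (gaussDrift_pos hc hx) (sub_pos.2 ?_)
    have hE := gaussPrimitive_pos hc hx
    have h := gaussPrimitive_sq_lt hc (le_of_lt hx)
    unfold gaussDrift
    rw [← lt_div_iff₀ (by positivity)] at h
    refine h.trans_eq ?_
    field_simp

/-- The primitive at m is at least (m/2) times the bump at m/2, so the quotient is at most (2/m)
exp(-3m²/(8a)). The exponent comes from m²/2 - (m/2)²/2 = 3m²/8. -/
lemma tendsto_gaussDrift {m : ℝ} (hm : 0 < m) :
    Tendsto (fun a => gaussDrift a⁻¹ m) (𝓝[>] 0) (𝓝 0) := by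
  have hlim : Tendsto (fun a : ℝ => 2 / m * Real.exp (-(3 * m ^ 2 / 8 * a⁻¹))) (𝓝[>] 0)
      (𝓝 (2 / m * 0)) := by
    refine Tendsto.const_mul _ (Real.tendsto_exp_neg_atTop_nhds_zero.comp ?_)
    exact tendsto_inv_nhdsGT_zero.const_mul_atTop (by positivity)
  rw [mul_zero] at hlim
  refine tendsto_of_tendsto_of_tendsto_of_le_of_le' tendsto_const_nhds hlim ?_ ?_
  · filter_upwards [self_mem_nhdsWithin] with a ha
    exact (gaussDrift_pos (inv_pos.2 ha) hm).le
  · filter_upwards [self_mem_nhdsWithin] with a ha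
    have hc : 0 < a⁻¹ := inv_pos.2 ha
    have h1 : m / 2 * gaussBump a⁻¹ (m / 2) ≤ gaussPrimitive a⁻¹ m :=
      (mul_gaussBump_le_gaussPrimitive hc (half_pos hm).le).trans
        (gaussPrimitive_mono (half_le_self hm.le))
    unfold gaussDrift
    rw [div_le_iff₀ (gaussPrimitive_pos hc hm)]
    refine le_trans (le_of_eq ?_) (mul_le_mul_of_nonneg_left h1 (by positivity))
    rw [show 2 / m * Real.exp (-(3 * m ^ 2 / 8 * a⁻¹)) * (m / 2 * gaussBump a⁻¹ (m / 2)) =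
      Real.exp (-(3 * m ^ 2 / 8 * a⁻¹)) * gaussBump a⁻¹ (m / 2) by field_simp]
    unfold gaussBump
    rw [← Real.exp_add]
    congr 1
    ring

/-! ### The flow of an equation with convex drift. -/

lemma IsDriftSolution.congr {b₁ b₂ : ℝ → ℝ} {x : ℝ} {f y : ℝ≥0 → ℝ}
    (h : IsDriftSolution b₁ x f y) (hb : EqOn b₁ b₂ (Ioi 0)) : IsDriftSolution b₂ x f y := by
  have e : (fun s : ℝ => b₁ (y s.toNNReal)) = fun s : ℝ => b₂ (y s.toNNReal) :=
    funext fun s => hb (h.pos _)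
  exact ⟨h.continuous, h.pos, e ▸ h.integrable, e ▸ h.eq⟩

/-- The exponential of the integral of `b'` along the path `y`: the derivative flow. -/
noncomputable def flowDeriv (b' : ℝ → ℝ) (y : ℝ≥0 → ℝ) (t : ℝ≥0) : ℝ :=
  Real.exp (∫ s in (0 : ℝ)..t, b' (y s.toNNReal))

lemma continuous_comp_path {g : ℝ → ℝ} (hg : ContinuousOn g (Ioi 0)) {y : ℝ≥0 → ℝ}
    (hy : Continuous y) (hpos : ∀ t, 0 < y t) : Continuous fun s : ℝ => g (y s.toNNReal) :=
  hg.comp_continuous (hy.comp continuous_real_toNNReal) fun _ => hpos _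

lemma monotone_on_nonneg_of_hasDerivAt {F F' : ℝ → ℝ} (hF : ∀ t, HasDerivAt F (F' t) t)
    (h : ∀ t, 0 < t → 0 ≤ F' t) {t : ℝ} (ht : 0 ≤ t) : F 0 ≤ F t := by
  refine monotoneOn_of_deriv_nonneg (convex_Ici 0)
    (fun x _ => (hF x).continuousAt.continuousWithinAt)
    (fun x _ => (hF x).differentiableAt.differentiableWithinAt) (fun x hx => ?_)
    self_mem_Ici ht ht
  rw [interior_Ici] at hx
  rw [(hF x).deriv]
  exact h x hx

/-- Comparison with the solutions of linear differential equations. -/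
lemma mul_exp_integral_le {D k p : ℝ → ℝ} (hk : Continuous k) (hp : Continuous p) (d : ℝ)
    (hD : ∀ t, D t = d + ∫ s in (0 : ℝ)..t, k s) (h : ∀ t, 0 < t → p t * D t ≤ k t)
    {t : ℝ} (ht : 0 ≤ t) : d * Real.exp (∫ s in (0 : ℝ)..t, p s) ≤ D t := by
  have hI : ∀ t, HasDerivAt (fun t => ∫ s in (0 : ℝ)..t, p s) (p t) t := fun t =>
    (hp.integral_hasStrictDerivAt 0 t).hasDerivAt
  have hD' : ∀ t, HasDerivAt D (k t) t := fun t => by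
    rw [funext hD]
    exact (hk.integral_hasStrictDerivAt 0 t).hasDerivAt.const_add d
  -- Integrating factor: D · exp(-∫p) has nonnegative derivative.
  have key := monotone_on_nonneg_of_hasDerivAt
    (F := fun t => D t * Real.exp (-∫ s in (0 : ℝ)..t, p s))
    (fun t => (hD' t).mul (hI t).neg.exp) (fun t ht => ?_) ht
  · simp only [intervalIntegral.integral_same, neg_zero, Real.exp_zero, mul_one] at key
    rw [hD 0, intervalIntegral.integral_same, add_zero, Real.exp_neg, ← div_eq_mul_inv,
      le_div_iff₀ (Real.exp_pos _)] at key
    exact key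
  · have := mul_nonneg (sub_nonneg.2 (h t ht)) (Real.exp_pos (-∫ s in (0 : ℝ)..t, p s)).le
    simp only [Pi.neg_apply]
    linarith

section Flow

variable {b b' : ℝ → ℝ} {f : ℝ≥0 → ℝ} {y : ℝ → ℝ≥0 → ℝ}

lemma flowDeriv_pos (z : ℝ≥0 → ℝ) (t : ℝ≥0) : 0 < flowDeriv b' z t := Real.exp_pos _

/-- The difference D = v - u satisfies D' = b(v) - b(u) ≥ b'(u) D by the tangent inequality,
whatever the sign of D. No order between x and z is assumed, so the roles can be exchanged. -/
lemma IsDriftSolution.flowDeriv_mul_le_sub (hb : IsConvexDrift b b') {x z : ℝ}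
    {u v : ℝ≥0 → ℝ} (hu : IsDriftSolution b x f u) (hv : IsDriftSolution b z f v) (t : ℝ≥0) :
    (z - x) * flowDeriv b' u t ≤ v t - u t := by
  have hcu := continuous_comp_path hb.continuousOn hu.continuous hu.pos
  have hcv := continuous_comp_path hb.continuousOn hv.continuous hv.pos
  have hcu' := continuous_comp_path hb.continuousOn_deriv hu.continuous hu.pos
  have hsub : ∀ s : ℝ≥0, v s - u s =
      (z - x) + ∫ r in (0 : ℝ)..s, (b (v r.toNNReal) - b (u r.toNNReal)) := fun s => by
    rw [intervalIntegral.integral_sub (hv.integrable s) (hu.integrable s), hu.eq, hv.eq]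
    ring
  rw [hsub]
  refine mul_exp_integral_le (hcv.sub hcu) hcu' (z - x) (fun t => rfl) (fun s hs => ?_) t.2
  have h1 := hsub s.toNNReal
  rw [Real.coe_toNNReal s hs.le] at h1
  simp only [Pi.sub_apply]
  rw [← h1]
  have := hb.tangent_le (hu.pos s.toNNReal) (hv.pos s.toNNReal)
  linarith

lemma flowDeriv_le_one (hb : IsConvexDrift b b') {u : ℝ≥0 → ℝ} (hu : ∀ t, 0 < u t) (t : ℝ≥0) :
    flowDeriv b' u t ≤ 1 := by
  unfold flowDeriv
  rw [Real.exp_le_one_iff]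
  have := intervalIntegral.integral_nonneg (μ := volume) (f := fun s : ℝ => -b' (u s.toNNReal)) t.2
    fun s _ => neg_nonneg.2 (hb.neg _ (hu _)).le
  rw [intervalIntegral.integral_neg] at this
  exact neg_nonneg.1 this

lemma IsDriftSolution.lt (hb : IsConvexDrift b b') {x z : ℝ} (hxz : x < z) {u v : ℝ≥0 → ℝ}
    (hu : IsDriftSolution b x f u) (hv : IsDriftSolution b z f v) (t : ℝ≥0) : u t < v t :=
  sub_pos.1 ((mul_pos (sub_pos.2 hxz) (flowDeriv_pos u t)).trans_le
    (hu.flowDeriv_mul_le_sub hb hv t))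

lemma IsDriftSolution.abs_sub_le (hb : IsConvexDrift b b') {x z : ℝ} {u v : ℝ≥0 → ℝ}
    (hu : IsDriftSolution b x f u) (hv : IsDriftSolution b z f v) (t : ℝ≥0) :
    |v t - u t| ≤ |z - x| := by
  have h1 := hu.flowDeriv_mul_le_sub hb hv t
  have h2 := hv.flowDeriv_mul_le_sub hb hu t
  have h3 := flowDeriv_le_one hb hu.pos t
  have h4 := flowDeriv_le_one hb hv.pos t
  have h5 := flowDeriv_pos (b' := b') u t
  have h6 := flowDeriv_pos (b' := b') v t
  rw [abs_le]
  rcases abs_cases (z - x) with ⟨e, h⟩ | ⟨e, h⟩ <;> rw [e] <;> constructor <;> nlinarith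

lemma IsDriftSolution.continuous_deriv (hb : IsConvexDrift b b') {x : ℝ} {u : ℝ≥0 → ℝ}
    (hu : IsDriftSolution b x f u) : Continuous fun s : ℝ => b' (u s.toNNReal) :=
  continuous_comp_path hb.continuousOn_deriv hu.continuous hu.pos

/-- Dominated convergence in the exponent. For z > x/2 the path from z lies above the path from x/2,
so -b' along the latter dominates, b' being increasing. -/
lemma tendsto_flowDeriv (hb : IsConvexDrift b b')
    (hy : ∀ x, 0 < x → IsDriftSolution b x f (y x)) {x : ℝ} (hx : 0 < x) (t : ℝ≥0) :
    Tendsto (fun z => flowDeriv b' (y z) t) (𝓝 x) (𝓝 (flowDeriv b' (y x) t)) := by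
  refine (Real.continuous_exp.tendsto _).comp ?_
  have hx2 := half_pos hx
  refine intervalIntegral.tendsto_integral_filter_of_dominated_convergence
    (fun s => -b' (y (x / 2) s.toNNReal)) ?_ ?_ ?_ ?_
  · filter_upwards [lt_mem_nhds hx] with z hz
    exact ((hy z hz).continuous_deriv hb).aestronglyMeasurable
  · filter_upwards [lt_mem_nhds (half_lt_self hx)] with z hz
    refine ae_of_all _ fun s _ => ?_
    have hz' := hy z (hx2.trans hz)
    have hl := (hy _ hx2).lt hb hz hz' s.toNNReal
    rw [Real.norm_eq_abs, abs_of_neg (hb.neg _ (hz'.pos _)), neg_le_neg_iff]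
    exact hb.strictMonoOn.monotoneOn ((hy _ hx2).pos _) (hz'.pos _) hl.le
  · exact (((hy _ hx2).continuous_deriv hb).neg).intervalIntegrable _ _
  · refine ae_of_all _ fun s _ => ?_
    have hpos := (hy x hx).pos s.toNNReal
    refine ((hb.continuousOn_deriv.continuousAt (Ioi_mem_nhds hpos)).tendsto).comp ?_
    rw [tendsto_iff_dist_tendsto_zero]
    refine squeeze_zero' (Eventually.of_forall fun _ => dist_nonneg) ?_
      (tendsto_iff_dist_tendsto_zero.1 tendsto_id)
    filter_upwards [lt_mem_nhds hx] with z hz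
    exact (hy x hx).abs_sub_le hb (hy z hz) _

/-- The flow is differentiable with respect to the starting point. -/
lemma hasDerivAt_flow (hb : IsConvexDrift b b')
    (hy : ∀ x, 0 < x → IsDriftSolution b x f (y x)) {x : ℝ} (hx : 0 < x) (t : ℝ≥0) :
    HasDerivAt (fun z => y z t) (flowDeriv b' (y x) t) x := by
  rw [hasDerivAt_iff_tendsto_slope]
  -- The slope between x and z lies between V(x) and V(z); taking min and max treats z < x and z > x
  -- together.
  have hV := (tendsto_flowDeriv hb hy hx t).mono_left (nhdsWithin_le_nhds (s := {x}ᶜ))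
  have hc : Tendsto (fun _ : ℝ => flowDeriv b' (y x) t) (𝓝[≠] x) (𝓝 (flowDeriv b' (y x) t)) :=
    tendsto_const_nhds
  have hmin := hc.min hV
  have hmax := hc.max hV
  rw [min_self] at hmin
  rw [max_self] at hmax
  refine tendsto_of_tendsto_of_tendsto_of_le_of_le' hmin hmax ?_ ?_
  all_goals
    filter_upwards [nhdsWithin_le_nhds (lt_mem_nhds hx), self_mem_nhdsWithin] with z hz hne
    have h1 := (hy x hx).flowDeriv_mul_le_sub hb (hy z hz) t
    have h2 := (hy z hz).flowDeriv_mul_le_sub hb (hy x hx) t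
    rw [slope_def_field]
    rcases lt_or_gt_of_ne (show z ≠ x from hne) with h | h
  · rw [min_le_iff, le_div_iff_of_neg (sub_neg.2 h), le_div_iff_of_neg (sub_neg.2 h)]
    right; linarith
  · rw [min_le_iff, le_div_iff₀ (sub_pos.2 h), le_div_iff₀ (sub_pos.2 h)]
    left; linarith
  · rw [le_max_iff, div_le_iff_of_neg (sub_neg.2 h), div_le_iff_of_neg (sub_neg.2 h)]
    left; linarith
  · rw [le_max_iff, div_le_iff₀ (sub_pos.2 h), div_le_iff₀ (sub_pos.2 h)]
    right; linarith

lemma flowDeriv_strictMono_start (hb : IsConvexDrift b b') {x z : ℝ} (hxz : x < z)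
    {u v : ℝ≥0 → ℝ} (hu : IsDriftSolution b x f u) (hv : IsDriftSolution b z f v)
    {t : ℝ≥0} (ht : 0 < t) : flowDeriv b' u t < flowDeriv b' v t := by
  have hlt : ∀ s : ℝ, b' (u s.toNNReal) < b' (v s.toNNReal) := fun s =>
    hb.strictMonoOn (hu.pos _) (hv.pos _) (hu.lt hb hxz hv _)
  refine Real.exp_lt_exp.2 (intervalIntegral.integral_lt_integral_of_continuousOn_of_le_of_exists_lt
    (NNReal.coe_pos.2 ht) (hu.continuous_deriv hb).continuousOn
    (hv.continuous_deriv hb).continuousOn (fun s _ => (hlt s).le) ⟨0, ⟨le_rfl, t.2⟩, hlt 0⟩)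

lemma flowDeriv_strictAnti (hb : IsConvexDrift b b') {x : ℝ} {u : ℝ≥0 → ℝ}
    (hu : IsDriftSolution b x f u) : StrictAnti (flowDeriv b' u) := by
  intro s t hst
  have hc := hu.continuous_deriv hb
  have hpos := intervalIntegral.intervalIntegral_pos_of_pos
    (f := fun r : ℝ => -b' (u r.toNNReal)) (hc.neg.intervalIntegrable s t)
    (fun r => neg_pos.2 (hb.neg _ (hu.pos _))) (NNReal.coe_lt_coe.2 hst)
  rw [intervalIntegral.integral_neg, neg_pos] at hpos
  have hadd := intervalIntegral.integral_add_adjacent_intervals (hc.intervalIntegrable 0 s)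
    (hc.intervalIntegrable (μ := volume) s t)
  exact Real.exp_lt_exp.2 (by linarith)

lemma continuous_flowDeriv (hb : IsConvexDrift b b') {x : ℝ} {u : ℝ≥0 → ℝ}
    (hu : IsDriftSolution b x f u) : Continuous (flowDeriv b' u) :=
  Real.continuous_exp.comp ((intervalIntegral.continuous_primitive
    (fun _ _ => (hu.continuous_deriv hb).intervalIntegrable _ _) 0).comp NNReal.continuous_coe)

/-- A lower bound for the derivative flow, as long as the path stays above `m`. -/
lemma IsDriftSolution.exp_le_flowDeriv (hb : IsConvexDrift b b') {x : ℝ} {u : ℝ≥0 → ℝ}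
    (hu : IsDriftSolution b x f u) {m : ℝ} (hm : 0 < m) {t : ℝ≥0} (h : ∀ s ≤ t, m ≤ u s) :
    Real.exp (t * b' m) ≤ flowDeriv b' u t := by
  refine Real.exp_le_exp.2 ?_
  have := intervalIntegral.integral_mono_on (μ := volume) t.2
    (intervalIntegrable_const (c := b' m))
    ((hu.continuous_deriv hb).intervalIntegrable 0 t)
    (fun s hs => hb.strictMonoOn.monotoneOn hm (hu.pos _)
      (h s.toNNReal (Real.toNNReal_le_iff_le_coe.2 hs.2)))
  simpa using this

end Flow

/-! ### Running maxima and Skorohod reflection. -/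

/-- The running maximum of a path. -/
noncomputable def runningMax (w : ℝ≥0 → ℝ) (t : ℝ≥0) : ℝ := sSup (w '' Icc 0 t)

lemma le_runningMax {w : ℝ≥0 → ℝ} (hw : Continuous w) {s t : ℝ≥0} (hst : s ≤ t) :
    w s ≤ runningMax w t :=
  le_csSup (isCompact_Icc.image hw).bddAbove ⟨s, ⟨zero_le, hst⟩, rfl⟩

lemma exists_eq_runningMax {w : ℝ≥0 → ℝ} (hw : Continuous w) (t : ℝ≥0) :
    ∃ s ≤ t, w s = runningMax w t := by
  obtain ⟨s, hs, e⟩ := (isCompact_Icc.image hw).sSup_mem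
    ((nonempty_Icc.2 (zero_le (a := t))).image w)
  exact ⟨s, hs.2, e⟩

lemma runningMax_le {w : ℝ≥0 → ℝ} (hw : Continuous w) {t : ℝ≥0} {c : ℝ}
    (h : ∀ s ≤ t, w s ≤ c) : runningMax w t ≤ c := by
  obtain ⟨s, hs, e⟩ := exists_eq_runningMax hw t
  exact e ▸ h s hs

lemma runningMax_mono {w : ℝ≥0 → ℝ} (hw : Continuous w) : Monotone (runningMax w) :=
  fun _ _ hst => runningMax_le hw fun _ hr => le_runningMax hw (hr.trans hst)

lemma runningMax_lt_iff {w : ℝ≥0 → ℝ} (hw : Continuous w) {t : ℝ≥0} {c : ℝ} :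
    runningMax w t < c ↔ ∀ s ≤ t, w s < c := by
  refine ⟨fun h s hs => (le_runningMax hw hs).trans_lt h, fun h => ?_⟩
  obtain ⟨s, hs, e⟩ := exists_eq_runningMax hw t
  exact e ▸ h s hs

lemma lt_runningMax_iff {w : ℝ≥0 → ℝ} (hw : Continuous w) {t : ℝ≥0} {c : ℝ} :
    c < runningMax w t ↔ ∃ s ≤ t, c < w s := by
  refine ⟨fun h => ?_, fun ⟨s, hs, h⟩ => h.trans_le (le_runningMax hw hs)⟩
  obtain ⟨s, hs, e⟩ := exists_eq_runningMax hw t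
  exact ⟨s, hs, e ▸ h⟩

namespace IsSkorohodSolution

variable {x : ℝ} {f g h : ℝ≥0 → ℝ}

/-- The regulator is constant on every interval on which the reflected path is positive. -/
lemma eq_of_pos (H : IsSkorohodSolution x f g h) {s t : ℝ≥0} (hst : s ≤ t)
    (hpos : ∀ r, s < r → r ≤ t → 0 < g r) : h s = h t := by
  rw [← H.flat s, ← H.flat t, ← integral_indicator measurableSet_Ioc,
    ← integral_indicator measurableSet_Ioc, indicator_indicator, indicator_indicator]
  have : Ioc (0 : ℝ) s ∩ {r : ℝ | g r.toNNReal = 0} =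
      Ioc (0 : ℝ) t ∩ {r : ℝ | g r.toNNReal = 0} := by
    refine Subset.antisymm (fun r ⟨⟨h0, h1⟩, h2⟩ => ⟨⟨h0, h1.trans (NNReal.coe_le_coe.2 hst)⟩, h2⟩)
      fun r ⟨⟨h0, h1⟩, h2⟩ => ⟨⟨h0, ?_⟩, h2⟩
    by_contra! hr
    exact (hpos r.toNNReal (Real.lt_toNNReal_iff_coe_lt.2 hr)
      (Real.toNNReal_le_iff_le_coe.2 h1)).ne' h2
  rw [this]

/-- **Skorohod's formula** for the reflected path. -/
lemma eq_add_max (H : IsSkorohodSolution x f g h) (hf : Continuous f)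
    (t : ℝ≥0) : g t = f t + max x (runningMax (fun s => -f s) t) := by
  have hw : Continuous fun s => -f s := hf.neg
  have h1 : max 0 (runningMax (fun s => -f s) t - x) ≤ h t := by
    refine max_le (H.zero ▸ H.monotone zero_le) (sub_le_iff_le_add.2 (runningMax_le hw ?_))
    intro s hs
    have := H.nonneg s
    rw [H.eq] at this
    have := H.monotone hs
    linarith
  have h2 : h t ≤ max 0 (runningMax (fun s => -f s) t - x) := by
    -- If h(t) > m, let s be the last time before t with h ≤ m. On (s,t] the regulator exceeds m, so
    -- g > 0 there and h(s) = h(t), a contradiction.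
    set m := max 0 (runningMax (fun s => -f s) t - x) with hm
    by_contra! hlt
    have hne : ({s | s ≤ t ∧ h s ≤ m} : Set ℝ≥0).Nonempty :=
      ⟨0, zero_le, H.zero ▸ le_max_left _ _⟩
    have hcl : IsCompact ({s | s ≤ t ∧ h s ≤ m} : Set ℝ≥0) :=
      isCompact_Icc.of_isClosed_subset (s := Icc 0 t)
        ((isClosed_le continuous_id continuous_const).inter
          (isClosed_le H.continuous continuous_const)) fun s hs => ⟨zero_le, hs.1⟩
    obtain ⟨hst, hsm⟩ := hcl.sSup_mem hne
    set s := sSup ({s | s ≤ t ∧ h s ≤ m} : Set ℝ≥0)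
    refine (hsm.trans_lt hlt).ne (H.eq_of_pos hst fun r hsr hrt => ?_)
    have hr : m < h r := by
      by_contra! hr
      exact (le_csSup hcl.bddAbove ⟨hrt, hr⟩).not_gt hsr
    have h3 := le_runningMax hw hrt
    have h4 : runningMax (fun s => -f s) t - x ≤ m := le_max_right _ _
    rw [H.eq]
    linarith
  rw [H.eq, le_antisymm h2 h1]
  rcases max_cases 0 (runningMax (fun s => -f s) t - x) with ⟨e, _⟩ | ⟨e, _⟩ <;>
    rcases max_cases x (runningMax (fun s => -f s) t) with ⟨e', _⟩ | ⟨e', _⟩ <;>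
    rw [e, e'] <;> linarith

lemma lt_firstZero_iff (H : IsSkorohodSolution x f g h) (hf : Continuous f) (hf0 : f 0 = 0)
    (hx : 0 < x) (t : ℝ≥0) :
    (t : ℝ≥0∞) < firstZero g ↔ runningMax (fun s => -f s) t < x := by
  have hw : Continuous fun s => -f s := hf.neg
  constructor
  · intro hlt
    by_contra! hM
    -- At a point s where the maximum is attained, M_s = -f(s) ≥ x, so the reflected path vanishes;
    -- s > 0 because f(0) = 0 < x.
    obtain ⟨s, hst, hs⟩ := exists_eq_runningMax hw t
    have hMs : runningMax (fun s => -f s) s = -f s :=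
      le_antisymm (hs ▸ runningMax_mono hw hst) (le_runningMax hw le_rfl)
    have hs0 : 0 < s := by
      rw [pos_iff_ne_zero]
      rintro rfl
      simp only [hf0, neg_zero] at hs
      linarith
    have hgs : g s = 0 := by
      rw [H.eq_add_max hf, hMs, max_eq_right (by linarith)]
      ring
    have : firstZero g ≤ (s : ℝ≥0∞) := iInf₂_le s ⟨hs0, hgs⟩
    exact (hlt.trans_le this).not_ge (ENNReal.coe_le_coe.2 hst)
  · intro hM
    have hlt : ∀ s ≤ t, -f s < x := (runningMax_lt_iff hw).1 hM
    -- A strict inequality t < τ is needed, so -f < x is first extended to a time c > t; there is no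
    -- zero before c.
    obtain ⟨c, hc, hIco⟩ := exists_Ico_subset_of_mem_nhds
      ((isOpen_lt hw continuous_const).mem_nhds (hlt t le_rfl)) ⟨t + 1, lt_add_one t⟩
    refine (ENNReal.coe_lt_coe.2 hc).trans_le (le_iInf₂ fun s hs => ENNReal.coe_le_coe.2 ?_)
    by_contra! hsc
    have hfs : -f s < x := by
      rcases le_total s t with hst | hst
      · exact hlt s hst
      · exact hIco ⟨hst, hsc⟩
    have := hs.2
    rw [H.eq_add_max hf] at this
    have := le_max_left x (runningMax (fun s => -f s) s)
    linarith

lemma apply_toNNReal_firstZero (H : IsSkorohodSolution x f g h) (hf : Continuous f)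
    (hf0 : f 0 = 0) (hx : 0 < x) (hfin : firstZero g ≠ ∞) : g (firstZero g).toNNReal = 0 := by
  have hw : Continuous fun s => -f s := hf.neg
  have hiff := H.lt_firstZero_iff hf hf0 hx
  rw [← ENNReal.coe_toNNReal hfin] at hiff
  set T := (firstZero g).toNNReal
  have hT : x ≤ runningMax (fun s => -f s) T := not_lt.1 fun h' => lt_irrefl _ ((hiff T).2 h')
  obtain ⟨s, hsT, hs⟩ := exists_eq_runningMax hw T
  have : s = T := by
    by_contra hne
    have h1 := (hiff s).1 (ENNReal.coe_lt_coe.2 (hsT.lt_of_ne hne))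
    have h2 := le_runningMax hw (le_refl s)
    linarith
  rw [H.eq_add_max hf, max_eq_right hT, ← hs, this]
  ring

lemma le_runningMax_of_firstZero_le (H : IsSkorohodSolution x f g h) (hf : Continuous f)
    (hf0 : f 0 = 0) (hx : 0 < x) {t : ℝ≥0} (ht : firstZero g ≤ t) :
    x ≤ runningMax (fun s => -f s) t :=
  not_lt.1 fun h' => ht.not_gt ((H.lt_firstZero_iff hf hf0 hx t).2 h')

end IsSkorohodSolution

/-! ### Spatial derivative of the reflected flow. -/

section ReflectedFlow

variable {f : ℝ≥0 → ℝ} {X L : ℝ → ℝ≥0 → ℝ}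

lemma reflected_flow_eventuallyEq
    (H : ∀ x, 0 ≤ x → IsSkorohodSolution x f (X x) (L x)) (hf : Continuous f) {x : ℝ}
    (hx : 0 < x) (t : ℝ≥0) :
    (fun z => X z t) =ᶠ[𝓝 x] fun z => f t + max z (runningMax (fun s => -f s) t) := by
  filter_upwards [lt_mem_nhds hx] with z hz
  exact (H z hz.le).eq_add_max hf t

lemma hasDerivAt_max_right (x m : ℝ) (hxm : x ≠ m) :
    HasDerivAt (fun z => max z m) (if m < x then 1 else 0) x := by
  rcases lt_or_gt_of_ne hxm with h | h
  · rw [if_neg h.not_gt]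
    refine (hasDerivAt_const x m).congr_of_eventuallyEq ?_
    filter_upwards [gt_mem_nhds h] with z hz using max_eq_right hz.le
  · rw [if_pos h]
    refine (hasDerivAt_id x).congr_of_eventuallyEq ?_
    filter_upwards [lt_mem_nhds h] with z hz using max_eq_left hz.le

lemma not_differentiableAt_max_right (m : ℝ) : ¬ DifferentiableAt ℝ (fun z => max z m) m := by
  intro h
  have h1 := h.hasDerivAt.hasDerivWithinAt (s := Ici m)
  have h2 := h.hasDerivAt.hasDerivWithinAt (s := Iic m)
  have e1 : HasDerivWithinAt (fun z => max z m) 1 (Ici m) m :=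
    (hasDerivWithinAt_id m _).congr (fun z hz => max_eq_left hz) (max_self m)
  have e2 : HasDerivWithinAt (fun z => max z m) 0 (Iic m) m :=
    (hasDerivWithinAt_const m _ m).congr (fun z hz => max_eq_right hz) (max_self m)
  have a1 := (uniqueDiffWithinAt_Ici m).eq_deriv _ h1 e1
  have a2 := (uniqueDiffWithinAt_Iic m).eq_deriv _ h2 e2
  exact one_ne_zero (a1.symm.trans a2)

lemma hasDerivAt_reflected_flow
    (H : ∀ x, 0 ≤ x → IsSkorohodSolution x f (X x) (L x)) (hf : Continuous f) {x : ℝ}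
    (hx : 0 < x) (t : ℝ≥0) (hne : x ≠ runningMax (fun s => -f s) t) :
    HasDerivAt (fun z => X z t) (if runningMax (fun s => -f s) t < x then 1 else 0) x :=
  ((hasDerivAt_max_right x _ hne).const_add (f t)).congr_of_eventuallyEq
    (reflected_flow_eventuallyEq H hf hx t)

lemma ne_runningMax_of_differentiableAt
    (H : ∀ x, 0 ≤ x → IsSkorohodSolution x f (X x) (L x)) (hf : Continuous f) {x : ℝ}
    (hx : 0 < x) (t : ℝ≥0) (hd : DifferentiableAt ℝ (fun z => X z t) x) :
    x ≠ runningMax (fun s => -f s) t := by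
  intro e
  rw [(reflected_flow_eventuallyEq H hf hx t).differentiableAt_iff, ← e] at hd
  refine not_differentiableAt_max_right x ?_
  simpa using hd.sub_const (f t)

/-- The spatial derivative of the reflected flow, with its value `0` where the flow is not
differentiable. -/
lemma deriv_reflected_flow
    (H : ∀ x, 0 ≤ x → IsSkorohodSolution x f (X x) (L x)) (hf : Continuous f) {x : ℝ}
    (hx : 0 < x) (t : ℝ≥0) :
    deriv (fun z => X z t) x = if runningMax (fun s => -f s) t < x then 1 else 0 := by
  by_cases hd : DifferentiableAt ℝ (fun z => X z t) x
  · exact (hasDerivAt_reflected_flow H hf hx t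
      (ne_runningMax_of_differentiableAt H hf hx t hd)).deriv
  · have : x = runningMax (fun s => -f s) t := by
      by_contra hne
      exact hd (hasDerivAt_reflected_flow H hf hx t hne).differentiableAt
    rw [deriv_zero_of_not_differentiableAt hd, if_neg (by rw [← this]; exact lt_irrefl x)]

end ReflectedFlow

/-! ### Comparison with the reflected path and the limit a ↓ 0. -/

/-- A solution with a convex drift is not far above the reflected path. -/
lemma IsDriftSolution.le_add_of_isSkorohodSolution {b b' : ℝ → ℝ} (hb : IsConvexDrift b b')
    {x : ℝ} {f u g h : ℝ≥0 → ℝ} (hf : Continuous f) (hu : IsDriftSolution b x f u)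
    (H : IsSkorohodSolution x f g h) {ε : ℝ} (hε : 0 < ε) (t : ℝ≥0) :
    u t ≤ g t + ε + t * b ε := by
  have hg : Continuous g := by
    rw [funext H.eq]
    exact (continuous_const.add hf).add H.continuous
  -- Let s be the last time before t with u ≤ g + ε. After s, u > ε and the drift is at most b(ε),
  -- while g increases at least as much as f.
  have hne : ({s | s ≤ t ∧ u s ≤ g s + ε} : Set ℝ≥0).Nonempty := by
    refine ⟨0, zero_le, ?_⟩
    rw [hu.eq, H.eq, H.zero]
    simp [hε.le]
  have hcl : IsCompact ({s | s ≤ t ∧ u s ≤ g s + ε} : Set ℝ≥0) :=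
    isCompact_Icc.of_isClosed_subset (s := Icc 0 t)
      ((isClosed_le continuous_id continuous_const).inter
        (isClosed_le hu.continuous (hg.add continuous_const))) fun s hs => ⟨zero_le, hs.1⟩
  obtain ⟨hst, hsm⟩ := hcl.sSup_mem hne
  set s := sSup ({s | s ≤ t ∧ u s ≤ g s + ε} : Set ℝ≥0)
  have hc := continuous_comp_path hb.continuousOn hu.continuous hu.pos
  have hint := intervalIntegral.integral_mono_on_of_le_Ioo (μ := volume)
    (NNReal.coe_le_coe.2 hst) (hc.intervalIntegrable s t)
    (intervalIntegrable_const (c := b ε)) (fun r hr => by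
      have hsr : s < r.toNNReal := Real.lt_toNNReal_iff_coe_lt.2 hr.1
      have hrt : r.toNNReal ≤ t := Real.toNNReal_le_iff_le_coe.2 hr.2.le
      have : g r.toNNReal + ε < u r.toNNReal := by
        by_contra! hr
        exact (le_csSup hcl.bddAbove ⟨hrt, hr⟩).not_gt hsr
      have := H.nonneg r.toNNReal
      exact hb.antitoneOn hε (by linarith))
  rw [intervalIntegral.integral_const, smul_eq_mul] at hint
  have hadd := intervalIntegral.integral_add_adjacent_intervals (hc.intervalIntegrable 0 s)
    (hc.intervalIntegrable (μ := volume) s t)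
  have h1 := hu.eq t
  have h2 := hu.eq s
  have h3 := H.eq t
  have h4 := H.eq s
  have h5 := H.monotone hst
  have h6 : 0 ≤ (s : ℝ) * b ε := mul_nonneg s.2 (hb.pos ε hε).le
  linarith

section Limit

variable {b b' : ℝ → ℝ → ℝ} {f : ℝ≥0 → ℝ} {y : ℝ → ℝ → ℝ≥0 → ℝ}

/-- At a zero of the path reflected from z, the solution started at z is at most ε + t b(ε), and it
bounds (z - x) V. Taking ε = η(z - x)/2 and then a small gives V < η. -/
lemma tendsto_flowDeriv_zero (hb : ∀ a, 0 < a → IsConvexDrift (b a) (b' a))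
    (hlim : ∀ m, 0 < m → Tendsto (fun a => b a m) (𝓝[>] 0) (𝓝 0)) (hf : Continuous f)
    (hy : ∀ a x, 0 < a → 0 < x → IsDriftSolution (b a) x f (y a x)) {x z : ℝ} (hx : 0 < x)
    (hxz : x < z) {g h : ℝ≥0 → ℝ} (H : IsSkorohodSolution z f g h) {t : ℝ≥0} (ht : g t = 0) :
    Tendsto (fun a => flowDeriv (b' a) (y a x) t) (𝓝[>] 0) (𝓝 0) := by
  rw [Metric.tendsto_nhds]
  intro η hη
  have hd := sub_pos.2 hxz
  have hε : 0 < η * (z - x) / 2 := by positivity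
  have hl := (hlim _ hε).const_mul (t : ℝ)
  rw [mul_zero] at hl
  filter_upwards [self_mem_nhdsWithin, hl.eventually_lt_const hε] with a (ha : 0 < a) hta
  rw [Real.dist_eq, sub_zero, abs_of_pos (flowDeriv_pos _ _)]
  have h1 := (hy a x ha hx).flowDeriv_mul_le_sub (hb a ha) (hy a z ha (hx.trans hxz)) t
  have h2 := (hy a z ha (hx.trans hxz)).le_add_of_isSkorohodSolution (hb a ha) hf H hε t
  have h3 := (hy a x ha hx).pos t
  rw [ht] at h2
  have : (z - x) * flowDeriv (b' a) (y a x) t < (z - x) * η := by linarith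
  exact lt_of_mul_lt_mul_left this hd.le

/-- A positive drift only pushes the path up, so it stays above m = x - M_t > 0 until t, where b' is
at least b'(m) → 0. -/
lemma tendsto_flowDeriv_one (hb : ∀ a, 0 < a → IsConvexDrift (b a) (b' a))
    (hlim : ∀ m, 0 < m → Tendsto (fun a => b a m) (𝓝[>] 0) (𝓝 0)) (hf : Continuous f)
    (hy : ∀ a x, 0 < a → 0 < x → IsDriftSolution (b a) x f (y a x)) {x : ℝ} (hx : 0 < x)
    {t : ℝ≥0} (ht : runningMax (fun s => -f s) t < x) :
    Tendsto (fun a => flowDeriv (b' a) (y a x) t) (𝓝[>] 0) (𝓝 1) := by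
  set m := x - runningMax (fun s => -f s) t with hmdef
  have hm : 0 < m := sub_pos.2 ht
  have hlow : Tendsto (fun a => Real.exp (-(t * (2 / m * b a (m / 2))))) (𝓝[>] 0) (𝓝 1) := by
    have := ((((hlim _ (half_pos hm)).const_mul (2 / m)).const_mul (t : ℝ)).neg).rexp
    simpa using this
  refine tendsto_of_tendsto_of_tendsto_of_le_of_le' hlow tendsto_const_nhds ?_ ?_
  · filter_upwards [self_mem_nhdsWithin] with a (ha : 0 < a)
    have hu := hy a x ha hx
    refine le_trans (Real.exp_le_exp.2 ?_)
      (hu.exp_le_flowDeriv (hb a ha) hm fun s hs => ?_)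
    · have := mul_le_mul_of_nonneg_left ((hb a ha).neg_deriv_le hm) t.2
      change (t : ℝ) * _ ≤ t * _ at this
      linarith
    · have h1 : -f s ≤ runningMax (fun s => -f s) t := le_runningMax (w := fun s => -f s) hf.neg hs
      rw [hu.eq]
      have := intervalIntegral.integral_nonneg (μ := volume)
        (f := fun r : ℝ => b a (y a x r.toNNReal)) s.2
        fun r _ => ((hb a ha).pos _ (hu.pos _)).le
      change 0 ≤ ∫ r in (0 : ℝ)..s, _ at this
      linarith
  · filter_upwards [self_mem_nhdsWithin] with a (ha : 0 < a)
    exact flowDeriv_le_one (hb a ha) (hy a x ha hx).pos t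

/-- The derivative flow converges at every time at which the reflected flow is differentiable. -/
lemma tendsto_flowDeriv_ite (hb : ∀ a, 0 < a → IsConvexDrift (b a) (b' a))
    (hlim : ∀ m, 0 < m → Tendsto (fun a => b a m) (𝓝[>] 0) (𝓝 0)) (hf : Continuous f)
    (hf0 : f 0 = 0)
    (hy : ∀ a x, 0 < a → 0 < x → IsDriftSolution (b a) x f (y a x)) {X L : ℝ → ℝ≥0 → ℝ}
    (H : ∀ x, 0 ≤ x → IsSkorohodSolution x f (X x) (L x)) {x : ℝ} (hx : 0 < x)
    {t : ℝ≥0} (ht : x ≠ runningMax (fun s => -f s) t) :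
    Tendsto (fun a => flowDeriv (b' a) (y a x) t) (𝓝[>] 0)
      (𝓝 (if runningMax (fun s => -f s) t < x then 1 else 0)) := by
  split_ifs with hlt
  · exact tendsto_flowDeriv_one hb hlim hf hy hx hlt
  · obtain ⟨z, hxz, hz⟩ := exists_between (lt_of_le_of_ne (not_lt.1 hlt) ht)
    have hz0 := hx.trans hxz
    have Hz := H z hz0.le
    have hle : firstZero (X z) ≤ t :=
      not_lt.1 fun h' => hz.not_gt ((Hz.lt_firstZero_iff hf hf0 hz0 t).1 h')
    have hfin : firstZero (X z) ≠ ∞ := ne_top_of_le_ne_top ENNReal.coe_ne_top hle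
    have h0 := Hz.apply_toNNReal_firstZero hf hf0 hz0 hfin
    have hT : (firstZero (X z)).toNNReal ≤ t := by
      simpa using ENNReal.toNNReal_mono ENNReal.coe_ne_top hle
    refine tendsto_of_tendsto_of_tendsto_of_le_of_le' tendsto_const_nhds
      (tendsto_flowDeriv_zero hb hlim hf hy hx hxz Hz h0)
      (Eventually.of_forall fun a => (flowDeriv_pos _ _).le) ?_
    filter_upwards [self_mem_nhdsWithin] with a (ha : 0 < a)
    exact (flowDeriv_strictAnti (hb a ha) (hy a x ha hx)).antitone hT

end Limit

/-! ### The reflection principle on a finite grid. -/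

lemma gaussianReal_Iic_eq_Ici (v : ℝ≥0) (x : ℝ) :
    gaussianReal 0 v (Iic (-x)) = gaussianReal 0 v (Ici x) := by
  have h := gaussianReal_map_neg (μ := 0) (v := v)
  rw [neg_zero] at h
  conv_lhs => rw [← h]
  rw [Measure.map_apply measurable_neg measurableSet_Iic]
  congr 1
  ext z
  simp

/-- The closed half line here, and the open one in the converse bound, allow v = 0, which occurs
when the first passage is at the final index. -/
lemma one_le_two_mul_gaussianReal_Ici (v : ℝ≥0) : 1 ≤ 2 * gaussianReal 0 v (Ici 0) := by
  have h := gaussianReal_Iic_eq_Ici v 0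
  rw [neg_zero] at h
  calc 1 = gaussianReal 0 v univ := measure_univ.symm
    _ = gaussianReal 0 v (Iic 0 ∪ Ici 0) := by rw [Iic_union_Ici]
    _ ≤ _ := measure_union_le _ _
    _ = _ := by rw [h, two_mul]

lemma two_mul_gaussianReal_Ioi_le_one (v : ℝ≥0) : 2 * gaussianReal 0 v (Ioi 0) ≤ 1 := by
  have h1 := measure_compl (μ := gaussianReal 0 v) (measurableSet_Iic (a := (0 : ℝ)))
    (measure_ne_top _ _)
  have h := gaussianReal_Iic_eq_Ici v 0
  rw [compl_Iic, measure_univ] at h1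
  rw [neg_zero] at h
  rw [two_mul]
  calc _ ≤ gaussianReal 0 v (Iic 0) + gaussianReal 0 v (Ioi 0) := by
        rw [h]
        gcongr
        exact Ioi_subset_Ici_self
    _ = gaussianReal 0 v univ := by
        rw [← measure_union (by simp) measurableSet_Ioi, Iic_union_Ioi]
    _ = 1 := measure_univ

section FirstPassage

variable {Ω : Type*} {W : ℝ≥0 → Ω → ℝ} {x : ℝ} {t : ℕ → ℝ≥0}

/-- The event that the process reaches the level `x` along `t` for the first time at index `k`. -/
def firstPassage (W : ℝ≥0 → Ω → ℝ) (t : ℕ → ℝ≥0) (x : ℝ) (k : ℕ) : Set Ω :=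
  {ω | x ≤ W (t k) ω ∧ ∀ j < k, W (t j) ω < x}

lemma disjoint_firstPassage {i j : ℕ} (hij : i ≠ j) :
    Disjoint (firstPassage W t x i) (firstPassage W t x j) := by
  rw [Set.disjoint_left]
  rintro ω ⟨h1, h2⟩ ⟨h3, h4⟩
  rcases lt_or_gt_of_ne hij with h | h
  · exact (h4 i h).not_ge h1
  · exact (h2 j h).not_ge h3

lemma iUnion_firstPassage (n : ℕ) :
    ⋃ k ∈ Finset.range (n + 1), firstPassage W t x k = {ω | ∃ k ≤ n, x ≤ W (t k) ω} := by
  ext ω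
  simp only [mem_iUnion, Finset.mem_range, Nat.lt_succ_iff, exists_prop]
  constructor
  · rintro ⟨k, hk, h, _⟩
    exact ⟨k, hk, h⟩
  · intro h
    classical
    have h' : ∃ k, x ≤ W (t k) ω := h.imp fun _ h => h.2
    obtain ⟨k, hk, hx⟩ := h
    exact ⟨Nat.find h', (Nat.find_min' h' hx).trans hk, Nat.find_spec h',
      fun j hj => not_le.1 (Nat.find_min h' hj)⟩

end FirstPassage

namespace ProbabilityTheory.IsPreBrownianReal

variable {Ω : Type*} [MeasurableSpace Ω] {P : Measure Ω} {W : ℝ≥0 → Ω → ℝ}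

/-- An increment is independent of the past. -/
lemma measure_inter_increment (hW : IsPreBrownianReal W P) {t T : ℝ≥0} (htT : t ≤ T)
    {A : Set Ω} {S : Set (Iic t → ℝ)} (hS : MeasurableSet S)
    (hA : A = (fun ω (s : Iic t) => W s ω) ⁻¹' S) {U : Set ℝ} (hU : MeasurableSet U) :
    P (A ∩ {ω | W T ω - W t ω ∈ U}) = gaussianReal 0 (nndist T.1 t.1) U * P A := by
  have h := (hW.indepFun_shift t).measure_inter_preimage_eq_mul
    ((fun u : ℝ≥0 → ℝ => u (T - t)) ⁻¹' U) S (measurable_pi_apply _ hU) hS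
  have hU' : (fun ω (u : ℝ≥0) => W (t + u) ω - W t ω) ⁻¹'
      ((fun u : ℝ≥0 → ℝ => u (T - t)) ⁻¹' U) = {ω | W T ω - W t ω ∈ U} := by
    ext ω
    simp [add_tsub_cancel_of_le htT]
  rw [hU', ← hA] at h
  rw [inter_comm, h]
  congr 1
  exact (hW.hasLaw_sub T t).measure_eq (p := (· ∈ U)) hU

variable {x : ℝ} {t : ℕ → ℝ≥0}

/-- Markov property at the first passage index: the event {index = k} is determined by the path up
to t k, hence independent of the later increment. -/
lemma firstPassage_inter_increment (hW : IsPreBrownianReal W P) (ht : Monotone t) {k n : ℕ}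
    (hkn : k ≤ n) {U : Set ℝ} (hU : MeasurableSet U) :
    P (firstPassage W t x k ∩ {ω | W (t n) ω - W (t k) ω ∈ U}) =
      gaussianReal 0 (nndist (t n).1 (t k).1) U * P (firstPassage W t x k) := by
  refine hW.measure_inter_increment (ht hkn)
    -- Coordinates must be indexed by times at most t k; the minimum ensures this and equals t j for
    -- j < k.
    (S := {w : Iic (t k) → ℝ | x ≤ w ⟨t k, self_mem_Iic⟩ ∧
      ∀ j < k, w ⟨min (t j) (t k), mem_Iic.2 (min_le_right _ _)⟩ < x}) ?_ ?_ hU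
  · refine (measurableSet_le measurable_const (measurable_pi_apply _)).inter ?_
    have : {w : Iic (t k) → ℝ | ∀ j < k, w ⟨min (t j) (t k), mem_Iic.2 (min_le_right _ _)⟩ < x} =
        ⋂ j ∈ {j | j < k}, {w | w ⟨min (t j) (t k), mem_Iic.2 (min_le_right _ _)⟩ < x} := by
      ext w; simp
    change MeasurableSet {w : Iic (t k) → ℝ |
      ∀ j < k, w ⟨min (t j) (t k), mem_Iic.2 (min_le_right _ _)⟩ < x}
    rw [this]
    exact MeasurableSet.biInter (to_countable _) fun j _ =>
      measurableSet_lt (measurable_pi_apply _) measurable_const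
  · ext ω
    simp only [firstPassage, mem_ofPred_eq, mem_preimage]
    refine and_congr_right fun _ => forall₂_congr fun j hj => ?_
    rw [min_eq_left (ht hj.le)]

lemma nullMeasurableSet_firstPassage (hW : IsPreBrownianReal W P) (k : ℕ) :
    NullMeasurableSet (firstPassage W t x k) P := by
  have : firstPassage W t x k =
      {ω | x ≤ W (t k) ω} ∩ ⋂ j ∈ {j | j < k}, {ω | W (t j) ω < x} := by
    ext ω
    simp [firstPassage]
  rw [this]
  exact (nullMeasurableSet_le aemeasurable_const (hW.aemeasurable _)).inter
    (NullMeasurableSet.biInter (to_countable _) fun j _ =>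
      nullMeasurableSet_lt (hW.aemeasurable _) aemeasurable_const)

lemma nullMeasurableSet_increment (hW : IsPreBrownianReal W P) (s r : ℝ≥0) {U : Set ℝ}
    (hU : MeasurableSet U) : NullMeasurableSet {ω | W s ω - W r ω ∈ U} P :=
  ((hW.aemeasurable s).sub (hW.aemeasurable r)).nullMeasurable hU

lemma sum_firstPassage (hW : IsPreBrownianReal W P) (n : ℕ) :
    ∑ k ∈ Finset.range (n + 1), P (firstPassage W t x k) = P {ω | ∃ k ≤ n, x ≤ W (t k) ω} := by
  rw [← iUnion_firstPassage, measure_biUnion_finset₀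
    (fun i _ j _ hij => (disjoint_firstPassage hij).aedisjoint)
    fun k _ => hW.nullMeasurableSet_firstPassage k]

lemma sum_firstPassage_inter (hW : IsPreBrownianReal W P) (n : ℕ) {U : Set ℝ}
    (hU : MeasurableSet U) :
    ∑ k ∈ Finset.range (n + 1), P (firstPassage W t x k ∩ {ω | W (t n) ω - W (t k) ω ∈ U}) =
      P (⋃ k ∈ Finset.range (n + 1),
        firstPassage W t x k ∩ {ω | W (t n) ω - W (t k) ω ∈ U}) := by
  rw [measure_biUnion_finset₀]
  · exact fun i _ j _ hij => ((disjoint_firstPassage hij).mono inter_subset_left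
      inter_subset_left).aedisjoint
  · exact fun k _ => (hW.nullMeasurableSet_firstPassage k).inter
      (hW.nullMeasurableSet_increment _ _ hU)

/-- Upper half of the discrete reflection principle. -/
lemma measure_exists_le_le (hW : IsPreBrownianReal W P) (ht : Monotone t) (n : ℕ) :
    P {ω | ∃ k ≤ n, x ≤ W (t k) ω} ≤ 2 * P {ω | x ≤ W (t n) ω} := by
  rw [← hW.sum_firstPassage]
  calc _ ≤ ∑ k ∈ Finset.range (n + 1),
        2 * P (firstPassage W t x k ∩ {ω | W (t n) ω - W (t k) ω ∈ Ici 0}) := by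
        refine Finset.sum_le_sum fun k hk => ?_
        rw [hW.firstPassage_inter_increment ht (Nat.lt_succ_iff.1 (Finset.mem_range.1 hk))
          measurableSet_Ici, ← mul_assoc]
        exact le_mul_of_one_le_left' (one_le_two_mul_gaussianReal_Ici _)
    _ = 2 * P (⋃ k ∈ Finset.range (n + 1),
        firstPassage W t x k ∩ {ω | W (t n) ω - W (t k) ω ∈ Ici 0}) := by
        rw [← Finset.mul_sum, hW.sum_firstPassage_inter n measurableSet_Ici]
    _ ≤ _ := by
        gcongr
        intro ω hω
        simp only [mem_iUnion, exists_prop] at hω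
        obtain ⟨k, _, ⟨h1, _⟩, h2⟩ := hω
        have h2' : 0 ≤ W (t n) ω - W (t k) ω := h2
        change x ≤ W (t n) ω
        linarith

/-- Lower half of the discrete reflection principle. -/
lemma two_mul_measure_le (hW : IsPreBrownianReal W P) (ht : Monotone t) (n : ℕ) {δ : ℝ}
    (hx : 0 < x) (hδ : 0 ≤ δ) {G : Set Ω} (hG0 : ∀ ω ∈ G, W (t 0) ω = 0)
    (hGn : ∀ ω ∈ G, x + δ < W (t n) ω)
    (hG : ∀ ω ∈ G, ∀ k < n, W (t (k + 1)) ω - W (t k) ω ≤ δ) :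
    2 * P G ≤ P {ω | ∃ k ≤ n, x ≤ W (t k) ω} := by
  rw [← hW.sum_firstPassage]
  calc _ ≤ 2 * P (⋃ k ∈ Finset.range (n + 1),
        firstPassage W t x k ∩ {ω | W (t n) ω - W (t k) ω ∈ Ioi 0}) := by
        gcongr
        intro ω hω
        have hmem : ω ∈ ⋃ k ∈ Finset.range (n + 1), firstPassage W t x k := by
          rw [iUnion_firstPassage]
          exact ⟨n, le_rfl, by linarith [hGn ω hω]⟩
        simp only [mem_iUnion, exists_prop] at hmem ⊢
        obtain ⟨k, hk, hk'⟩ := hmem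
        refine ⟨k, hk, hk', ?_⟩
        rw [mem_ofPred_eq, mem_Ioi]
        rcases k with _ | k
        · rw [hG0 ω hω]
          linarith [hGn ω hω]
        -- The overshoot at first passage is at most δ, so a final value above x + δ forces a
        -- positive later increment.
        · have h1 := hk'.2 k (lt_add_one k)
          have h2 := hG ω hω k (Nat.lt_of_succ_lt_succ (Finset.mem_range.1 hk))
          linarith [hGn ω hω]
    _ = ∑ k ∈ Finset.range (n + 1),
        2 * P (firstPassage W t x k ∩ {ω | W (t n) ω - W (t k) ω ∈ Ioi 0}) := by
        rw [← Finset.mul_sum, hW.sum_firstPassage_inter n measurableSet_Ioi]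
    _ ≤ _ := by
        refine Finset.sum_le_sum fun k hk => ?_
        rw [hW.firstPassage_inter_increment ht (Nat.lt_succ_iff.1 (Finset.mem_range.1 hk))
          measurableSet_Ioi, ← mul_assoc]
        exact mul_le_of_le_one_left' (two_mul_gaussianReal_Ioi_le_one _)

end ProbabilityTheory.IsPreBrownianReal

/-! ### From the grid to continuous time. -/

/-- The regular grid with `n` steps on `[0, a]`. -/
noncomputable def regularGrid (a : ℝ≥0) (n k : ℕ) : ℝ≥0 := a * (k / n)

lemma regularGrid_mono (a : ℝ≥0) (n : ℕ) : Monotone (regularGrid a n) := by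
  intro i j hij
  unfold regularGrid
  gcongr

lemma regularGrid_self (a : ℝ≥0) {n : ℕ} (hn : n ≠ 0) : regularGrid a n n = a := by
  unfold regularGrid
  rw [div_self (Nat.cast_ne_zero.2 hn), mul_one]

lemma regularGrid_zero (a : ℝ≥0) (n : ℕ) : regularGrid a n 0 = 0 := by
  simp [regularGrid]

lemma eventually_exists_le_regularGrid {w : ℝ≥0 → ℝ} (hw : Continuous w) {a s : ℝ≥0}
    (ha : 0 < a) (hs : s ≤ a) {x : ℝ} (hx : x < w s) :
    ∀ᶠ n : ℕ in atTop, ∃ k ≤ n, x ≤ w (regularGrid a n k) := by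
  have h1 : Tendsto (fun n : ℕ => (⌊((s / a : ℝ≥0) : ℝ) * n⌋₊ / n : ℝ)) atTop
      (𝓝 ((s / a : ℝ≥0) : ℝ)) :=
    (tendsto_nat_floor_mul_div_atTop (NNReal.coe_nonneg _)).comp tendsto_natCast_atTop_atTop
  have h2 : Tendsto (fun n : ℕ => regularGrid a n ⌊((s / a : ℝ≥0) : ℝ) * n⌋₊) atTop (𝓝 s) := by
    have : Tendsto (fun n : ℕ => (⌊((s / a : ℝ≥0) : ℝ) * n⌋₊ / n : ℝ≥0)) atTop (𝓝 (s / a)) := by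
      rw [← NNReal.tendsto_coe]
      simpa using h1
    have h3 := this.const_mul a
    rwa [mul_div_cancel₀ _ ha.ne'] at h3
  filter_upwards [((hw.tendsto s).comp h2).eventually_const_lt hx] with n hn
  refine ⟨_, ?_, hn.le⟩
  refine Nat.floor_le_of_le (mul_le_of_le_one_left n.cast_nonneg ?_)
  exact_mod_cast div_le_one_of_le₀ hs zero_le

lemma eventually_increment_le {w : ℝ≥0 → ℝ} (hw : Continuous w) (a : ℝ≥0) {δ : ℝ} (hδ : 0 < δ) :
    ∀ᶠ n : ℕ in atTop, ∀ k < n, w (regularGrid a n (k + 1)) - w (regularGrid a n k) ≤ δ := by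
  obtain ⟨η, hη, h⟩ := Metric.uniformContinuousOn_iff.1
    ((isCompact_Icc (a := (0 : ℝ≥0)) (b := a)).uniformContinuousOn_of_continuous hw.continuousOn)
    δ hδ
  have hlim : Tendsto (fun n : ℕ => (a : ℝ) / n) atTop (𝓝 0) :=
    tendsto_const_div_atTop_nhds_zero_nat _
  filter_upwards [hlim.eventually_lt_const hη, eventually_gt_atTop 0] with n hn hn0 k hk
  have hle : ∀ j ≤ n, regularGrid a n j ∈ Icc 0 a := fun j hj =>
    ⟨zero_le, (regularGrid_mono a n hj).trans_eq (regularGrid_self a hn0.ne')⟩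
  refine (le_abs_self _).trans (h _ (hle _ hk) _ (hle _ hk.le) ?_).le
  rw [NNReal.dist_eq]
  have : ((regularGrid a n (k + 1) : ℝ≥0) : ℝ) - regularGrid a n k = a / n := by
    simp only [regularGrid, NNReal.coe_mul, NNReal.coe_div, NNReal.coe_natCast]
    push_cast
    ring
  rwa [this, abs_of_nonneg (by positivity)]

namespace ProbabilityTheory.IsBrownianReal

variable {Ω : Type*} [MeasurableSpace Ω] {P : Measure Ω} {W : ℝ≥0 → Ω → ℝ}

lemma measure_lt_runningMax_le (hW : IsBrownianReal W P) {a : ℝ≥0} (ha : 0 < a) (x : ℝ) :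
    P {ω | x < runningMax (fun s => W s ω) a} ≤ 2 * P {ω | x ≤ W a ω} := by
  -- The grids are not nested, so the events "for all n ≥ N" are used: they increase with N, and
  -- each is bounded through the single grid n = N + 1, which has at least one step.
  set E : ℕ → Set Ω := fun N => {ω | ∀ n ≥ N, ∃ k ≤ n, x ≤ W (regularGrid a n k) ω} with hE
  have hmono : Monotone E := fun N N' h ω hω n hn => hω n (h.trans hn)
  calc _ ≤ P (⋃ N, E N) := by
        refine measure_mono_ae ?_
        filter_upwards [hW.cont] with ω hω h
        obtain ⟨s, hs, hx⟩ := (lt_runningMax_iff hω).1 h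
        obtain ⟨N, hN⟩ := eventually_atTop.1 (eventually_exists_le_regularGrid hω ha hs hx)
        exact mem_iUnion.2 ⟨N, hN⟩
    _ = ⨆ N, P (E N) := hmono.measure_iUnion
    _ ≤ _ := by
        refine iSup_le fun N => ?_
        calc P (E N) ≤ P (E (N + 1)) := measure_mono (hmono N.le_succ)
          _ ≤ P {ω | ∃ k ≤ N + 1, x ≤ W (regularGrid a (N + 1) k) ω} :=
            measure_mono fun ω hω => hω (N + 1) le_rfl
          _ ≤ _ := hW.measure_exists_le_le (regularGrid_mono a (N + 1)) (N + 1)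
          _ = _ := by rw [regularGrid_self a N.succ_ne_zero]

lemma two_mul_measure_lt_le (hW : IsBrownianReal W P) (a : ℝ≥0) {x y : ℝ}
    (hx : 0 < x) (hxy : x < y) :
    2 * P {ω | y < W a ω} ≤ P {ω | x ≤ runningMax (fun s => W s ω) a} := by
  set E : ℕ → Set Ω := fun N => {ω | W 0 ω = 0 ∧ y < W a ω ∧ ∀ n ≥ N, ∀ k < n,
    W (regularGrid a n (k + 1)) ω - W (regularGrid a n k) ω ≤ y - x} with hE
  have hmono : Monotone E := fun N N' h ω hω =>
    ⟨hω.1, hω.2.1, fun n hn => hω.2.2 n (h.trans hn)⟩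
  calc _ ≤ 2 * P (⋃ N, E N) := by
        refine mul_le_mul_right (measure_mono_ae ?_) 2
        filter_upwards [hW.cont, hW.eval_zero_ae_eq_zero] with ω hω h0 h
        obtain ⟨N, hN⟩ := eventually_atTop.1 (eventually_increment_le hω a (sub_pos.2 hxy))
        exact mem_iUnion.2 ⟨N, h0, h, hN⟩
    _ = ⨆ N, 2 * P (E N) := by rw [hmono.measure_iUnion, ENNReal.mul_iSup]
    _ ≤ _ := by
        refine iSup_le fun N => ?_
        calc 2 * P (E N) ≤ 2 * P (E (N + 1)) := by
              gcongr
              exact hmono N.le_succ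
          _ ≤ P {ω | ∃ k ≤ N + 1, x ≤ W (regularGrid a (N + 1) k) ω} := by
              refine hW.two_mul_measure_le (regularGrid_mono a (N + 1)) (N + 1) hx
                (sub_pos.2 hxy).le (fun ω hω => ?_) (fun ω hω => ?_)
                (fun ω hω => hω.2.2 (N + 1) le_rfl)
              · rw [regularGrid_zero]
                exact hω.1
              · rw [regularGrid_self a N.succ_ne_zero]
                simpa using hω.2.1
          _ ≤ _ := by
              refine measure_mono_ae ?_
              filter_upwards [hW.cont] with ω hω h
              obtain ⟨k, hk, hx⟩ := h
              exact hx.trans (le_runningMax hω ((regularGrid_mono a _ hk).trans_eq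
                (regularGrid_self a N.succ_ne_zero)))

/-- By path continuity the supremum may be taken over a countable dense set of times. -/
lemma nullMeasurableSet_lt_runningMax (hW : IsBrownianReal W P) (a : ℝ≥0) (x : ℝ) :
    NullMeasurableSet {ω | x < runningMax (fun s => W s ω) a} P := by
  have : Nonempty (Icc 0 a) := ⟨⟨0, le_rfl, zero_le⟩⟩
  have h : NullMeasurableSet
      (⋃ n, {ω | x < W (TopologicalSpace.denseSeq (Icc 0 a) n) ω}) P :=
    NullMeasurableSet.iUnion fun n => nullMeasurableSet_lt aemeasurable_const (hW.aemeasurable _)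
  refine h.congr ?_
  filter_upwards [hW.cont] with ω hω
  refine propext ?_
  change ω ∈ ⋃ n, {ω | x < W (TopologicalSpace.denseSeq (Icc 0 a) n) ω} ↔ x < runningMax _ a
  rw [lt_runningMax_iff hω, mem_iUnion]
  constructor
  · rintro ⟨n, hn⟩
    exact ⟨_, (TopologicalSpace.denseSeq (Icc 0 a) n).2.2, hn⟩
  · rintro ⟨s, hs, hx⟩
    obtain ⟨n, hn⟩ :=
      (TopologicalSpace.denseRange_denseSeq (Icc 0 a)).exists_mem_open
        (isOpen_lt continuous_const (hω.comp continuous_subtype_val))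
        ⟨⟨s, zero_le, hs⟩, hx⟩
    exact ⟨n, hn⟩

lemma nullMeasurableSet_runningMax_lt (hW : IsBrownianReal W P) (a : ℝ≥0) (x : ℝ) :
    NullMeasurableSet {ω | runningMax (fun s => W s ω) a < x} P := by
  have : {ω | runningMax (fun s => W s ω) a < x} =
      (⋂ n : ℕ, {ω | x - 1 / (n + 1) < runningMax (fun s => W s ω) a})ᶜ := by
    ext ω
    simp only [mem_compl_iff, mem_iInter, not_forall, mem_ofPred_eq, not_lt]
    constructor
    · intro h
      obtain ⟨n, hn⟩ := exists_nat_one_div_lt (sub_pos.2 h)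
      exact ⟨n, by linarith⟩
    · rintro ⟨n, hn⟩
      have : (0 : ℝ) < 1 / (n + 1) := by positivity
      linarith
  rw [this]
  exact (NullMeasurableSet.iInter fun n => hW.nullMeasurableSet_lt_runningMax a _).compl

end ProbabilityTheory.IsBrownianReal

/-! ### The law of the running maximum. -/

lemma gaussianReal_real_Ici_zero {v : ℝ≥0} (hv : v ≠ 0) :
    (gaussianReal 0 v).real (Ici 0) = 1 / 2 := by
  have := nullSingletonClass_gaussianReal (μ := 0) hv
  have h1 := one_le_two_mul_gaussianReal_Ici v
  have h2 := two_mul_gaussianReal_Ioi_le_one v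
  rw [measure_congr (Ioi_ae_eq_Ici (μ := gaussianReal 0 v) (a := 0))] at h2
  have h3 := congrArg ENNReal.toReal (le_antisymm h2 h1)
  rw [ENNReal.toReal_mul] at h3
  simp only [ENNReal.toReal_ofNat, ENNReal.toReal_one] at h3
  rw [measureReal_def]
  linarith

lemma gaussianReal_real_Ici {v : ℝ≥0} (hv : v ≠ 0) {x : ℝ} (hx : 0 ≤ x) :
    (gaussianReal 0 v).real (Ici x) = 1 / 2 - ∫ z in (0 : ℝ)..x, gaussianPDFReal 0 v z := by
  rw [← gaussianReal_real_Ici_zero hv, ← Ico_union_Ici_eq_Ici hx,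
    measureReal_union (by
      rw [Set.disjoint_left]
      exact fun z hz hz' => (not_le.2 hz.2) hz') measurableSet_Ici,
    measureReal_def (s := Ico 0 x), gaussianReal_apply_eq_integral 0 hv (Ico 0 x),
    ENNReal.toReal_ofReal (integral_nonneg fun z => gaussianPDFReal_nonneg 0 v z),
    intervalIntegral.integral_of_le hx, integral_Ico_eq_integral_Ioc]
  ring

lemma gaussianReal_real_Ioi {v : ℝ≥0} (hv : v ≠ 0) {x : ℝ} (hx : 0 ≤ x) :
    (gaussianReal 0 v).real (Ioi x) = 1 / 2 - ∫ z in (0 : ℝ)..x, gaussianPDFReal 0 v z := by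
  have := nullSingletonClass_gaussianReal (μ := 0) hv
  rw [← gaussianReal_real_Ici hv hx, measureReal_def, measureReal_def, measure_congr Ioi_ae_eq_Ici]

lemma integral_gaussianPDFReal_eq (v : ℝ≥0) (x : ℝ) :
    ∫ z in (0 : ℝ)..x, gaussianPDFReal 0 v z =
      (√(2 * Real.pi * v))⁻¹ * gaussPrimitive (v : ℝ)⁻¹ x := by
  rw [gaussPrimitive, ← intervalIntegral.integral_const_mul]
  congr 1
  ext z
  rw [gaussianPDFReal, gaussBump]
  congr 2
  ring

lemma continuous_gaussPrimitive (c : ℝ) : Continuous (gaussPrimitive c) :=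
  continuous_iff_continuousAt.2 fun x => (hasDerivAt_gaussPrimitive c x).continuousAt

namespace ProbabilityTheory.IsBrownianReal

variable {Ω : Type*} [MeasurableSpace Ω] {P : Measure Ω} {W : ℝ≥0 → Ω → ℝ}

/-- **Reflection principle**: the distribution function of the running maximum. -/
lemma measureReal_runningMax_lt [IsProbabilityMeasure P] (hW : IsBrownianReal W P) {a : ℝ≥0}
    (ha : 0 < a) {x : ℝ} (hx : 0 < x) :
    P.real {ω | runningMax (fun s => W s ω) a < x} =
      2 * (√(2 * Real.pi * a))⁻¹ * gaussPrimitive (a : ℝ)⁻¹ x := by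
  set Φ : ℝ → ℝ := fun x => (√(2 * Real.pi * a))⁻¹ * gaussPrimitive (a : ℝ)⁻¹ x with hΦ
  have hcont : Continuous Φ := continuous_const.mul (continuous_gaussPrimitive _)
  have hcompl := probReal_compl_eq_one_sub₀ (hW.nullMeasurableSet_runningMax_lt a x)
  set p := P.real {ω | runningMax (fun s => W s ω) a < x}ᶜ with hp
  have hpset : {ω | runningMax (fun s => W s ω) a < x}ᶜ =
      {ω | x ≤ runningMax (fun s => W s ω) a} := by
    ext ω
    simp
  -- The two halves of the reflection principle bound P(M_a ≥ x) only through levels z ≠ x;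
  -- continuity of Φ closes the gap from both sides.
  have h1 : ∀ z, 0 < z → z < x → p ≤ 1 - 2 * Φ z := by
    intro z hz hzx
    have h := hW.measure_lt_runningMax_le ha z
    have hlaw := (hW.hasLaw_eval a).measure_eq (p := (z ≤ ·)) measurableSet_Ici
    rw [hlaw] at h
    have h' := ENNReal.toReal_mono (by finiteness) ((measure_mono (fun ω hω => ?_)).trans h :
      P {ω | runningMax (fun s => W s ω) a < x}ᶜ ≤ _)
    · rw [ENNReal.toReal_mul, ENNReal.toReal_ofNat] at h'
      have e := gaussianReal_real_Ici ha.ne' hz.le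
      rw [integral_gaussianPDFReal_eq] at e
      change p ≤ 2 * (gaussianReal 0 a).real (Ici z) at h'
      rw [e] at h'
      simp only [hΦ]
      linarith
    · rw [hpset] at hω
      exact hzx.trans_le hω
  have h2 : ∀ z, x < z → 1 - 2 * Φ z ≤ p := by
    intro z hxz
    have h := hW.two_mul_measure_lt_le a hx hxz
    have hlaw := (hW.hasLaw_eval a).measure_eq (p := (z < ·)) measurableSet_Ioi
    rw [hlaw, ← hpset] at h
    have h' := ENNReal.toReal_mono (by finiteness) h
    rw [ENNReal.toReal_mul, ENNReal.toReal_ofNat] at h'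
    have e := gaussianReal_real_Ioi ha.ne' (hx.trans hxz).le
    rw [integral_gaussianPDFReal_eq] at e
    change 2 * (gaussianReal 0 a).real (Ioi z) ≤ p at h'
    rw [e] at h'
    simp only [hΦ]
    linarith
  have hF : Continuous fun z => 1 - 2 * Φ z := by fun_prop
  have hle : p ≤ 1 - 2 * Φ x := by
    refine ge_of_tendsto ((hF.tendsto x).mono_left (nhdsWithin_le_nhds (s := Iio x))) ?_
    filter_upwards [Ioo_mem_nhdsLT hx] with z hz using h1 z hz.1 hz.2
  have hge : 1 - 2 * Φ x ≤ p := by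
    refine le_of_tendsto ((hF.tendsto x).mono_left (nhdsWithin_le_nhds (s := Ioi x))) ?_
    filter_upwards [self_mem_nhdsWithin] with z hz using h2 z hz
  have : p = 1 - 2 * Φ x := le_antisymm hle hge
  rw [mul_assoc]
  change _ = 2 * Φ x
  linarith

lemma ae_ne_runningMax [IsProbabilityMeasure P] (hW : IsBrownianReal W P) {a : ℝ≥0} (ha : 0 < a)
    {x : ℝ} (hx : 0 < x) : ∀ᵐ ω ∂P, x ≠ runningMax (fun s => W s ω) a := by
  rw [ae_iff, ← measureReal_eq_zero_iff]
  set C := 2 * (√(2 * Real.pi * a))⁻¹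
  refine le_antisymm ?_ measureReal_nonneg
  -- An atom at x has mass at most P(M < z) - P(M < x) for every z > x, which vanishes as z ↓ x.
  have hlim : Tendsto (fun z => C * gaussPrimitive (a : ℝ)⁻¹ z - C * gaussPrimitive (a : ℝ)⁻¹ x)
      (𝓝[>] x) (𝓝 0) := by
    have h := (((continuous_gaussPrimitive (a : ℝ)⁻¹).tendsto x).mono_left
      (nhdsWithin_le_nhds (s := Ioi x))).const_mul C
    simpa using h.sub_const (C * gaussPrimitive (a : ℝ)⁻¹ x)
  refine ge_of_tendsto hlim ?_
  filter_upwards [self_mem_nhdsWithin] with z (hz : x < z)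
  rw [← hW.measureReal_runningMax_lt ha hx, ← hW.measureReal_runningMax_lt ha (hx.trans hz),
    le_sub_iff_add_le, ← measureReal_union₀ (hW.nullMeasurableSet_runningMax_lt a x)
    (Disjoint.aedisjoint ?_)]
  · refine measureReal_mono ?_
    rintro ω (h | h)
    all_goals
      simp only [mem_ofPred_eq, not_not] at h ⊢
      linarith
  · rw [Set.disjoint_left]
    intro ω h h'
    simp only [mem_ofPred_eq, not_not] at h h'
    exact h'.ne h.symm

lemma ae_exists_le_runningMax [IsProbabilityMeasure P] (hW : IsBrownianReal W P) :
    ∀ᵐ ω ∂P, ∀ x : ℝ, ∃ t : ℝ≥0, x ≤ runningMax (fun s => W s ω) t := by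
  have key : ∀ n : ℕ, ∀ᵐ ω ∂P, ∃ t : ℝ≥0, (n + 1 : ℝ) ≤ runningMax (fun s => W s ω) t := by
    intro n
    have hx : (0 : ℝ) < n + 1 := by positivity
    rw [ae_iff, ← measureReal_eq_zero_iff]
    refine le_antisymm ?_ measureReal_nonneg
    -- P(M_k < n + 1) is at most 2(n + 1)/√(2πk), since the bump is at most 1.
    have hlim : Tendsto (fun k : ℕ => 2 * (√(2 * Real.pi * k))⁻¹ * (n + 1 : ℝ)) atTop (𝓝 0) := by
      have h1 : Tendsto (fun k : ℕ => √(2 * Real.pi * k)) atTop atTop :=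
        Real.tendsto_sqrt_atTop.comp
          (tendsto_natCast_atTop_atTop.const_mul_atTop (by positivity))
      simpa using (h1.inv_tendsto_atTop.const_mul 2).mul_const (n + 1 : ℝ)
    refine ge_of_tendsto hlim ?_
    filter_upwards [eventually_gt_atTop 0] with k hk
    have hk' : (0 : ℝ≥0) < k := Nat.cast_pos.2 hk
    calc _ ≤ P.real {ω | runningMax (fun s => W s ω) (k : ℝ≥0) < n + 1} := by
          refine measureReal_mono fun ω hω => ?_
          simp only [mem_ofPred_eq, not_exists, not_le] at hω ⊢
          exact hω k
      _ = _ := hW.measureReal_runningMax_lt hk' hx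
      _ ≤ _ := by
          rw [NNReal.coe_natCast]
          gcongr
          have := intervalIntegral.integral_mono_on (μ := volume) hx.le
            ((continuous_gaussBump (k : ℝ)⁻¹).intervalIntegrable 0 (n + 1))
            (intervalIntegrable_const (c := 1)) fun z hz => by
              rw [gaussBump, Real.exp_le_one_iff]
              have : 0 ≤ (k : ℝ)⁻¹ * z ^ 2 / 2 := by positivity
              linarith
          simpa [gaussPrimitive] using this
  filter_upwards [ae_all_iff.2 key] with ω hω x
  obtain ⟨n, hn⟩ := exists_nat_ge x
  obtain ⟨t, ht⟩ := hω n
  exact ⟨t, by linarith⟩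

end ProbabilityTheory.IsBrownianReal

/-! ### Pathwise statements. -/

/-- A driving path `f`, its reflected flow `X` with regulators `L`, and the solution flows `y a` of
the equations with the drifts `b a`. -/
structure IsFlowPath (b : ℝ → ℝ → ℝ) (f : ℝ≥0 → ℝ) (X L : ℝ → ℝ≥0 → ℝ)
    (y : ℝ → ℝ → ℝ≥0 → ℝ) : Prop where
  continuous : Continuous f
  zero : f 0 = 0
  reflected : ∀ x, 0 ≤ x → IsSkorohodSolution x f (X x) (L x)
  drift : ∀ a x, 0 < a → 0 < x → IsDriftSolution (b a) x f (y a x)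

namespace IsFlowPath

variable {b b' : ℝ → ℝ → ℝ} {f : ℝ≥0 → ℝ} {X L : ℝ → ℝ≥0 → ℝ} {y : ℝ → ℝ → ℝ≥0 → ℝ}

lemma hasDerivAt (hb : ∀ a, 0 < a → IsConvexDrift (b a) (b' a)) (H : IsFlowPath b f X L y)
    {a x : ℝ} (ha : 0 < a) (hx : 0 < x) (t : ℝ≥0) :
    HasDerivAt (fun z => y a z t) (flowDeriv (b' a) (y a x) t) x :=
  hasDerivAt_flow (hb a ha) (fun x hx => H.drift a x ha hx) hx t

lemma lt_firstZero_iff (H : IsFlowPath b f X L y) {x : ℝ} (hx : 0 < x) (t : ℝ≥0) :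
    (t : ℝ≥0∞) < firstZero (X x) ↔ runningMax (fun s => -f s) t < x :=
  (H.reflected x hx.le).lt_firstZero_iff H.continuous H.zero hx t

/-- Valid also at t = τ(x): if the flow has a kink there, the default value 0 of `deriv` agrees with
the strict inequality. This gives right continuity in time. -/
lemma deriv_eq_ite (H : IsFlowPath b f X L y) {x : ℝ} (hx : 0 < x) (t : ℝ≥0) :
    deriv (fun z => X z t) x = if (t : ℝ≥0∞) < firstZero (X x) then 1 else 0 := by
  rw [deriv_reflected_flow H.reflected H.continuous hx]
  exact if_congr (H.lt_firstZero_iff hx t).symm rfl rfl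

lemma tendsto_deriv_zero (hb : ∀ a, 0 < a → IsConvexDrift (b a) (b' a))
    (hlim : ∀ m, 0 < m → Tendsto (fun a => b a m) (𝓝[>] 0) (𝓝 0)) (H : IsFlowPath b f X L y)
    {x z : ℝ} (hx : 0 < x) (hxz : x < z) (hfin : firstZero (X z) ≠ ∞) :
    Tendsto (fun a => deriv (fun w => y a w (firstZero (X z)).toNNReal) x) (𝓝[>] 0) (𝓝 0) := by
  have hz := hx.trans hxz
  have Hz := H.reflected z hz.le
  refine (tendsto_flowDeriv_zero hb hlim H.continuous H.drift hx hxz Hz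
    (Hz.apply_toNNReal_firstZero H.continuous H.zero hz hfin)).congr' ?_
  filter_upwards [self_mem_nhdsWithin] with a (ha : 0 < a)
  exact (H.hasDerivAt hb ha hx _).deriv.symm

lemma tendsto_deriv (hb : ∀ a, 0 < a → IsConvexDrift (b a) (b' a))
    (hlim : ∀ m, 0 < m → Tendsto (fun a => b a m) (𝓝[>] 0) (𝓝 0)) (H : IsFlowPath b f X L y)
    {x : ℝ} (hx : 0 < x) {t : ℝ≥0} (ht : x ≠ runningMax (fun s => -f s) t) :
    Tendsto (fun a => deriv (fun w => y a w t) x) (𝓝[>] 0) (𝓝 (deriv (fun z => X z t) x)) := by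
  rw [deriv_reflected_flow H.reflected H.continuous hx]
  refine (tendsto_flowDeriv_ite hb hlim H.continuous H.zero H.drift H.reflected hx ht).congr' ?_
  filter_upwards [self_mem_nhdsWithin] with a (ha : 0 < a)
  exact (H.hasDerivAt hb ha hx _).deriv.symm

/-- A level that is not the running maximum at a positive rational time is the running maximum
at most at the time at which it is reached. -/
lemma ne_runningMax (H : IsFlowPath b f X L y) {x : ℝ} (hx : 0 < x)
    (hq : ∀ q : ℚ, 0 < (q : ℝ).toNNReal → x ≠ runningMax (fun s => -f s) (q : ℝ).toNNReal)
    {t : ℝ≥0} (ht : (t : ℝ≥0∞) ≠ firstZero (X x)) : x ≠ runningMax (fun s => -f s) t := by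
  rcases lt_or_gt_of_ne ht with h | h
  · exact ((H.lt_firstZero_iff hx t).1 h).ne'
  -- At a rational time q between τ(x) and t, x ≤ M_q and x ≠ M_q give x < M_q ≤ M_t. Countably many
  -- excluded events thus handle all times.
  · obtain ⟨q, _, h1, h2⟩ := ENNReal.lt_iff_exists_rat_btwn.1 h
    have hxq := (H.reflected x hx.le).le_runningMax_of_firstZero_le H.continuous H.zero hx h1.le
    refine (lt_of_lt_of_le (hxq.lt_of_ne (hq q ?_))
      (runningMax_mono H.continuous.neg (ENNReal.coe_lt_coe.1 h2).le)).ne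
    exact ENNReal.coe_pos.1 (lt_of_le_of_lt zero_le h1)

lemma hasDerivAt_and_tendsto (hb : ∀ a, 0 < a → IsConvexDrift (b a) (b' a))
    (hlim : ∀ m, 0 < m → Tendsto (fun a => b a m) (𝓝[>] 0) (𝓝 0)) (H : IsFlowPath b f X L y)
    {x : ℝ} (hx : 0 < x)
    (hq : ∀ q : ℚ, 0 < (q : ℝ).toNNReal → x ≠ runningMax (fun s => -f s) (q : ℝ).toNNReal)
    {t : ℝ≥0} (ht : (t : ℝ≥0∞) ≠ firstZero (X x)) :
    HasDerivAt (fun z => X z t) (if (t : ℝ≥0∞) < firstZero (X x) then 1 else 0) x ∧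
      Tendsto (fun a => deriv (fun w => y a w t) x) (𝓝[>] 0) (𝓝 (deriv (fun z => X z t) x)) := by
  have hne := H.ne_runningMax hx hq ht
  refine ⟨?_, H.tendsto_deriv hb hlim hx hne⟩
  rw [← H.deriv_eq_ite hx]
  exact (hasDerivAt_reflected_flow H.reflected H.continuous hx t hne).differentiableAt.hasDerivAt

lemma abs_deriv_sub_deriv_le (hb : ∀ a, 0 < a → IsConvexDrift (b a) (b' a))
    (H : IsFlowPath b f X L y) {a x : ℝ} (ha : 0 < a) (hx : 0 < x) (t : ℝ≥0) :
    |deriv (fun w => y a w t) x - deriv (fun z => X z t) x| ≤ 1 := by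
  rw [(H.hasDerivAt hb ha hx t).deriv, H.deriv_eq_ite hx]
  have h1 := flowDeriv_pos (b' := b' a) (y a x) t
  have h2 := flowDeriv_le_one (hb a ha) (H.drift a x ha hx).pos t
  rw [abs_le]
  split_ifs <;> constructor <;> linarith

lemma isRightContinuous_deriv_sub (hb : ∀ a, 0 < a → IsConvexDrift (b a) (b' a))
    (H : IsFlowPath b f X L y) {a x : ℝ} (ha : 0 < a) (hx : 0 < x) (t : ℝ≥0) :
    ContinuousWithinAt
      (fun t => deriv (fun w => y a w t) x - deriv (fun z => X z t) x) (Ioi t) t := by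
  simp_rw [(H.hasDerivAt hb ha hx _).deriv, H.deriv_eq_ite hx]
  refine (continuous_flowDeriv (hb a ha) (H.drift a x ha hx)).continuousWithinAt.sub ?_
  by_cases h : (t : ℝ≥0∞) < firstZero (X x)
  · refine (continuousWithinAt_const (b := 1)).congr_of_eventuallyEq ?_ (if_pos h)
    filter_upwards [nhdsWithin_le_nhds
      ((ENNReal.continuous_coe.tendsto t).eventually_lt_const h)] with s hs using if_pos hs
  · refine (continuousWithinAt_const (b := 0)).congr (fun s hs => if_neg fun hs' => h ?_) (if_neg h)
    exact (ENNReal.coe_lt_coe.2 hs).trans hs'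

lemma measurable_deriv_sub (hb : ∀ a, 0 < a → IsConvexDrift (b a) (b' a))
    (H : IsFlowPath b f X L y) {a x : ℝ} (ha : 0 < a) (hx : 0 < x) :
    Measurable fun t : ℝ≥0 => deriv (fun w => y a w t) x - deriv (fun z => X z t) x := by
  simp_rw [(H.hasDerivAt hb ha hx _).deriv, H.deriv_eq_ite hx]
  refine (continuous_flowDeriv (hb a ha) (H.drift a x ha hx)).measurable.sub
    (Measurable.ite ?_ measurable_const measurable_const)
  exact measurableSet_lt ENNReal.continuous_coe.measurable measurable_const

lemma tendsto_integral_abs (hb : ∀ a, 0 < a → IsConvexDrift (b a) (b' a))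
    (hlim : ∀ m, 0 < m → Tendsto (fun a => b a m) (𝓝[>] 0) (𝓝 0)) (H : IsFlowPath b f X L y)
    {x : ℝ} (hx : 0 < x)
    (hq : ∀ q : ℚ, 0 < (q : ℝ).toNNReal → x ≠ runningMax (fun s => -f s) (q : ℝ).toNNReal)
    (T : ℝ) (hT : 0 < T) :
    Tendsto (fun a => ∫ t in (0 : ℝ)..T, |deriv (fun w => y a w t.toNNReal) x -
      deriv (fun z => X z t.toNNReal) x|) (𝓝[>] 0) (𝓝 0) := by
  rw [show 𝓝 (0 : ℝ) = 𝓝 (∫ _ in (0 : ℝ)..T, (0 : ℝ)) by simp]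
  refine intervalIntegral.tendsto_integral_filter_of_dominated_convergence (fun _ => 1)
    ?_ ?_ intervalIntegrable_const ?_
  · filter_upwards [self_mem_nhdsWithin] with a (ha : 0 < a)
    exact ((H.measurable_deriv_sub hb ha hx).comp measurable_real_toNNReal).abs.aestronglyMeasurable
  · filter_upwards [self_mem_nhdsWithin] with a (ha : 0 < a)
    refine ae_of_all _ fun t _ => ?_
    rw [Real.norm_eq_abs, abs_abs]
    exact H.abs_deriv_sub_deriv_le hb ha hx _
  · filter_upwards [(countable_singleton (firstZero (X x)).toReal).ae_notMem volume] with t ht hmem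
    rw [uIoc_of_le hT.le] at hmem
    have hne : (t.toNNReal : ℝ≥0∞) ≠ firstZero (X x) := by
      intro e
      refine ht ?_
      rw [mem_singleton_iff, ← e, ENNReal.coe_toReal, Real.coe_toNNReal t hmem.1.le]
    have h := ((H.hasDerivAt_and_tendsto hb hlim hx hq hne).2.sub_const
      (deriv (fun z => X z t.toNNReal) x)).abs
    simpa using h

end IsFlowPath

/-! ### Joint measurability. -/

section Measurability

variable {Ω : Type*} [MeasurableSpace Ω] {P : Measure Ω}

/-- A right-continuous process is jointly measurable. -/
lemma aestronglyMeasurable_prod_of_rightContinuous [SFinite P] (ν : Measure ℝ) [SFinite ν]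
    {Z : ℝ≥0 → Ω → ℝ} (hm : ∀ t, 0 < t → AEMeasurable (Z t) P)
    (hc : ∀ᵐ ω ∂P, ∀ t, ContinuousWithinAt (fun t => Z t ω) (Ioi t) t) :
    AEStronglyMeasurable (fun p : ℝ × Ω => Z p.1.toNNReal p.2) (ν.prod P) := by
  -- With k = ⌊(n+1)t⌋, the time (k+1)/(n+1) is strictly larger than t and converges to it. It is
  -- also positive, so measurability at time 0 is not needed.
  set g : ℕ → ℕ → ℝ≥0 := fun n k => (k + 1) / (n + 1) with hg
  have hgpos : ∀ n k, 0 < g n k := fun n k => by positivity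
  set i : ℕ → ℝ → ℕ := fun n t => ⌊((n + 1 : ℕ) : ℝ≥0) * t.toNNReal⌋₊ with hi
  have hi_meas : ∀ n, Measurable (i n) := fun n =>
    Nat.measurable_floor.comp (measurable_real_toNNReal.const_mul _)
  have hlim : ∀ t : ℝ, Tendsto (fun n => g n (i n t)) atTop (𝓝[>] t.toNNReal) := by
    intro t
    have hlt : ∀ n, t.toNNReal < g n (i n t) := fun n => by
      have := Nat.lt_floor_add_one (((n + 1 : ℕ) : ℝ≥0) * t.toNNReal)
      simp only [hg, hi]
      rw [lt_div_iff₀ (by positivity), mul_comm]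
      exact_mod_cast this
    refine tendsto_nhdsWithin_iff.2 ⟨?_, Eventually.of_forall hlt⟩
    have hle : ∀ n, g n (i n t) ≤ t.toNNReal + 1 / ((n : ℝ≥0) + 1) := fun n => by
      have := Nat.floor_le (a := ((n + 1 : ℕ) : ℝ≥0) * t.toNNReal) zero_le
      simp only [hg, hi]
      rw [add_div]
      gcongr
      rw [div_le_iff₀ (by positivity), mul_comm t.toNNReal]
      exact_mod_cast this
    have hup : Tendsto (fun n : ℕ => t.toNNReal + 1 / ((n : ℝ≥0) + 1)) atTop (𝓝 t.toNNReal) := by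
      have := (tendsto_one_div_add_atTop_nhds_zero_nat (𝕜 := ℝ≥0)).const_add t.toNNReal
      simpa using this
    exact tendsto_of_tendsto_of_tendsto_of_le_of_le tendsto_const_nhds hup
      (fun n => (hlt n).le) hle
  have hmk : ∀ᵐ ω ∂P, ∀ n k, Z (g n k) ω = (hm _ (hgpos n k)).mk (Z (g n k)) ω :=
    ae_all_iff.2 fun n => ae_all_iff.2 fun k => (hm _ (hgpos n k)).ae_eq_mk
  refine aestronglyMeasurable_of_tendsto_ae (u := atTop)
    (f := fun n (p : ℝ × Ω) => (hm _ (hgpos n (i n p.1))).mk (Z (g n (i n p.1))) p.2)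
    (fun n => ?_) ?_
  -- The discretised process depends on time only through an integer, so it is measurable on a
  -- countable product.
  · have h1 : Measurable fun q : ℕ × Ω => (hm _ (hgpos n q.1)).mk (Z (g n q.1)) q.2 :=
      measurable_from_prod_countable_right fun k => (hm _ (hgpos n k)).measurable_mk
    exact (h1.comp (((hi_meas n).comp measurable_fst).prodMk measurable_snd)).aestronglyMeasurable
  · filter_upwards [Measure.quasiMeasurePreserving_snd.ae hmk,
      Measure.quasiMeasurePreserving_snd.ae hc] with p h1 h2
    simp_rw [← h1]
    exact (h2 p.1.toNNReal).tendsto.comp (hlim p.1)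

lemma aemeasurable_deriv_of_ae_differentiableAt {F : ℝ → Ω → ℝ} {x : ℝ} (hx : 0 < x)
    (hF : ∀ z, 0 < z → AEMeasurable (F z) P)
    (hd : ∀ᵐ ω ∂P, DifferentiableAt ℝ (fun z => F z ω) x) :
    AEMeasurable (fun ω => deriv (fun z => F z ω) x) P := by
  have hseq : Tendsto (fun n : ℕ => x + 1 / ((n : ℝ) + 1)) atTop (𝓝[≠] x) := by
    refine tendsto_nhdsWithin_iff.2 ⟨?_, Eventually.of_forall fun n => ?_⟩
    · simpa using tendsto_one_div_add_atTop_nhds_zero_nat.const_add x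
    · have : (0 : ℝ) < 1 / ((n : ℝ) + 1) := by positivity
      simpa using this.ne'
  refine aemeasurable_of_tendsto_metrizable_ae atTop
    (f := fun (n : ℕ) ω => slope (fun z => F z ω) x (x + 1 / ((n : ℝ) + 1))) (fun n => ?_) ?_
  · simp_rw [slope_def_field]
    exact ((hF _ (by positivity)).sub (hF x hx)).div_const _
  · filter_upwards [hd] with ω hω
    exact (hasDerivAt_iff_tendsto_slope.1 hω.hasDerivAt).comp hseq

end Measurability

/-! ### Identification of the drift and the theorem. -/

section Drift

variable {Ω : Type*} [MeasurableSpace Ω] {P : Measure Ω} [IsProbabilityMeasure P]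
  {B : ℝ≥0 → Ω → ℝ} {X L : ℝ → ℝ≥0 → Ω → ℝ}

/-- The survival probability is a Gaussian distribution function. -/
lemma survivalProb_eq (hB : IsBrownianReal B P)
    (hX : ∀ᵐ ω ∂P, ∀ x : ℝ, 0 ≤ x →
      IsSkorohodSolution x (fun t => B t ω) (fun t => X x t ω) (fun t => L x t ω))
    {a x : ℝ} (ha : 0 < a) (hx : 0 < x) :
    survivalProb P X a x = 2 * (√(2 * Real.pi * a))⁻¹ * gaussPrimitive a⁻¹ x := by
  have h := hB.neg.measureReal_runningMax_lt (Real.toNNReal_pos.2 ha) hx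
  rw [Real.coe_toNNReal a ha.le] at h
  rw [← h, survivalProb]
  refine measureReal_congr ?_
  filter_upwards [hX, hB.cont, hB.eval_zero_ae_eq_zero] with ω h1 h2 h3
  exact propext ((h1 x hx.le).lt_firstZero_iff h2 h3 hx a.toNNReal)

lemma logDrift_eq (hB : IsBrownianReal B P)
    (hX : ∀ᵐ ω ∂P, ∀ x : ℝ, 0 ≤ x →
      IsSkorohodSolution x (fun t => B t ω) (fun t => X x t ω) (fun t => L x t ω))
    {a x : ℝ} (ha : 0 < a) (hx : 0 < x) : logDrift P X a x = gaussDrift a⁻¹ x := by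
  set C := 2 * (√(2 * Real.pi * a))⁻¹
  have hC : 0 < C := by positivity
  have hE := gaussPrimitive_pos (inv_pos.2 ha) hx
  have hd := ((hasDerivAt_gaussPrimitive a⁻¹ x).const_mul C).log (by positivity)
  have he : (fun z => Real.log (survivalProb P X a z)) =ᶠ[𝓝 x]
      fun z => Real.log (C * gaussPrimitive a⁻¹ z) := by
    filter_upwards [lt_mem_nhds hx] with z hz
    rw [survivalProb_eq hB hX ha hz]
  rw [logDrift, he.deriv_eq, hd.deriv, gaussDrift]
  field_simp

end Drift

theorem theoremA {Ω : Type*} [MeasurableSpace Ω] (P : Measure Ω) [IsProbabilityMeasure P]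
    (B : ℝ≥0 → Ω → ℝ) (hB : IsBrownianReal B P)
    -- the Skorohod reflected Brownian motion `X x t` and its boundary local time `L x t`
    (X L : ℝ → ℝ≥0 → Ω → ℝ)
    (hX : ∀ᵐ ω ∂P, ∀ x : ℝ, 0 ≤ x →
      IsSkorohodSolution x (fun t => B t ω) (fun t => X x t ω) (fun t => L x t ω))
    -- the solution flows `Y a x t` of the approximating equations
    (Y : ℝ → ℝ → ℝ≥0 → Ω → ℝ)
    (hYmeas : ∀ a x : ℝ, 0 < a → 0 < x → ∀ t, AEMeasurable (Y a x t) P)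
    (hY : ∀ᵐ ω ∂P, ∀ a x : ℝ, 0 < a → 0 < x →
      IsDriftSolution (logDrift P X a) x (fun t => B t ω) (fun t => Y a x t ω)) :
    -- (1) the derivative flow exists, with its monotonicity, and its limit at `τ(y)`
    (∀ᵐ ω ∂P,
      (∀ a x : ℝ, 0 < a → 0 < x → ∀ t, DifferentiableAt ℝ (fun z => Y a z t ω) x) ∧
      (∀ a : ℝ, 0 < a → ∀ t : ℝ≥0, 0 < t →
        StrictMonoOn (fun x => spatialDeriv (Y a) x t ω) (Ioi 0)) ∧
      (∀ a x : ℝ, 0 < a → 0 < x → StrictAnti (fun t => spatialDeriv (Y a) x t ω)) ∧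
      (∀ x y : ℝ, 0 < x → x < y →
        firstZero (fun t => X y t ω) ≠ ∞ ∧
        Tendsto (fun a => spatialDeriv (Y a) x (firstZero (fun t => X y t ω)).toNNReal ω)
          (𝓝[>] 0) (𝓝 0))) ∧
    -- (2) almost sure convergence, at each fixed starting point
    (∀ x : ℝ, 0 < x → ∀ᵐ ω ∂P, ∀ t : ℝ≥0, (t : ℝ≥0∞) ≠ firstZero (fun s => X x s ω) →
      HasDerivAt (fun z => X z t ω)
        (if (t : ℝ≥0∞) < firstZero (fun s => X x s ω) then 1 else 0) x ∧
      Tendsto (fun a => spatialDeriv (Y a) x t ω) (𝓝[>] 0) (𝓝 (spatialDeriv X x t ω))) ∧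
    -- almost sure convergence, simultaneously at all starting points outside a countable set,
    -- and for all starting points and times at which the limit flow is differentiable
    (∀ᵐ ω ∂P,
      (∃ N : Set ℝ, N.Countable ∧
        ∀ x : ℝ, 0 < x → x ∉ N → ∀ t : ℝ≥0, (t : ℝ≥0∞) ≠ firstZero (fun s => X x s ω) →
          HasDerivAt (fun z => X z t ω)
            (if (t : ℝ≥0∞) < firstZero (fun s => X x s ω) then 1 else 0) x ∧
          Tendsto (fun a => spatialDeriv (Y a) x t ω) (𝓝[>] 0) (𝓝 (spatialDeriv X x t ω))) ∧
      (∀ x : ℝ, 0 < x → ∀ t : ℝ≥0, DifferentiableAt ℝ (fun z => X z t ω) x →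
        Tendsto (fun a => spatialDeriv (Y a) x t ω) (𝓝[>] 0) (𝓝 (spatialDeriv X x t ω)))) ∧
    -- convergence in `L¹(dt × P)`
    (∀ x T : ℝ, 0 < x → 0 < T →
      (∀ a : ℝ, 0 < a → Integrable
        (fun p : ℝ × Ω => spatialDeriv (Y a) x p.1.toNNReal p.2 - spatialDeriv X x p.1.toNNReal p.2)
        ((volume.restrict (Ioc 0 T)).prod P)) ∧
      Tendsto (fun a => ∫ ω, (∫ t in (0 : ℝ)..T,
          |spatialDeriv (Y a) x t.toNNReal ω - spatialDeriv X x t.toNNReal ω|) ∂P)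
        (𝓝[>] 0) (𝓝 0)) := by
  set b : ℝ → ℝ → ℝ := fun a => gaussDrift a⁻¹ with hbdef
  set b' : ℝ → ℝ → ℝ := fun a => gaussDriftDeriv a⁻¹ with hbdef'
  have hb : ∀ a, 0 < a → IsConvexDrift (b a) (b' a) := fun a ha =>
    isConvexDrift_gaussDrift (inv_pos.2 ha)
  have hlim : ∀ m, 0 < m → Tendsto (fun a => b a m) (𝓝[>] 0) (𝓝 0) := fun m hm =>
    tendsto_gaussDrift hm
  have hpath : ∀ᵐ ω ∂P, IsFlowPath b (fun t => B t ω) (fun x t => X x t ω) (fun x t => L x t ω)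
      (fun a x t => Y a x t ω) := by
    filter_upwards [hX, hY, hB.cont, hB.eval_zero_ae_eq_zero] with ω h1 h2 h3 h4
    exact ⟨h3, h4, h1, fun a x ha hx => (h2 a x ha hx).congr fun z hz => logDrift_eq hB hX ha hz⟩
  have hlevel : ∀ x : ℝ, 0 < x → ∀ᵐ ω ∂P, ∀ q : ℚ, 0 < (q : ℝ).toNNReal →
      x ≠ runningMax (fun s => -B s ω) (q : ℝ).toNNReal := fun x hx =>
    ae_all_iff.2 fun q => eventually_imp_distrib_left.2 fun hq => hB.neg.ae_ne_runningMax hq hx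
  refine ⟨?_, ?_, ?_, ?_⟩
  · filter_upwards [hpath, hB.neg.ae_exists_le_runningMax] with ω H hsup
    refine ⟨fun a x ha hx t => (H.hasDerivAt hb ha hx t).differentiableAt, ?_, ?_, ?_⟩
    · intro a ha t ht x hx z hz hxz
      simp only [spatialDeriv]
      rw [(H.hasDerivAt hb ha hx t).deriv, (H.hasDerivAt hb ha hz t).deriv]
      exact flowDeriv_strictMono_start (hb a ha) hxz (H.drift a x ha hx) (H.drift a z ha hz) ht
    · intro a x ha hx s t hst
      simp only [spatialDeriv]
      rw [(H.hasDerivAt hb ha hx t).deriv, (H.hasDerivAt hb ha hx s).deriv]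
      exact flowDeriv_strictAnti (hb a ha) (H.drift a x ha hx) hst
    · intro x z hx hxz
      have hfin : firstZero (fun t => X z t ω) ≠ ∞ := by
        intro htop
        obtain ⟨t, ht⟩ := hsup z
        refine ht.not_gt ((H.lt_firstZero_iff (hx.trans hxz) t).1 ?_)
        rw [htop]
        exact ENNReal.coe_lt_top
      exact ⟨hfin, H.tendsto_deriv_zero hb hlim hx hxz hfin⟩
  · intro x hx
    filter_upwards [hpath, hlevel x hx] with ω H hq t ht
    exact H.hasDerivAt_and_tendsto hb hlim hx hq ht
  · filter_upwards [hpath] with ω H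
    -- The exceptional levels are the running maxima of -B at rational times.
    refine ⟨⟨range fun q : ℚ => runningMax (fun s => -B s ω) (q : ℝ).toNNReal,
      countable_range _, fun x hx hxN t ht => ?_⟩, fun x hx t hd => ?_⟩
    · exact H.hasDerivAt_and_tendsto hb hlim hx (fun q _ e => hxN ⟨q, e.symm⟩) ht
    · exact H.tendsto_deriv hb hlim hx
        (ne_runningMax_of_differentiableAt H.reflected H.continuous hx t hd)
  · intro x T hx hT
    have hint : ∀ a : ℝ, 0 < a → Integrable (fun p : ℝ × Ω =>
        spatialDeriv (Y a) x p.1.toNNReal p.2 - spatialDeriv X x p.1.toNNReal p.2)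
        ((volume.restrict (Ioc 0 T)).prod P) := by
      intro a ha
      refine Integrable.of_bound (C := 1) ?_ ?_
      · refine aestronglyMeasurable_prod_of_rightContinuous (volume.restrict (Ioc 0 T))
          (Z := fun t ω => spatialDeriv (Y a) x t ω - spatialDeriv X x t ω) (fun t ht => ?_) ?_
        · refine AEMeasurable.sub (aemeasurable_deriv_of_ae_differentiableAt hx
            (fun z hz => hYmeas a z ha hz t) ?_) ?_
          · filter_upwards [hpath] with ω H using (H.hasDerivAt hb ha hx t).differentiableAt
          · refine ((aemeasurable_const (b := (1 : ℝ))).indicator₀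
              (hB.neg.nullMeasurableSet_runningMax_lt t x)).congr ?_
            filter_upwards [hpath] with ω H
            rw [spatialDeriv, deriv_reflected_flow H.reflected H.continuous hx]
            rfl
        · filter_upwards [hpath] with ω H t using H.isRightContinuous_deriv_sub hb ha hx t
      · filter_upwards [Measure.quasiMeasurePreserving_snd.ae hpath] with p H
        exact H.abs_deriv_sub_deriv_le hb ha hx _
    refine ⟨hint, ?_⟩
    rw [show 𝓝 (0 : ℝ) = 𝓝 (∫ _, (0 : ℝ) ∂P) by simp]
    refine tendsto_integral_filter_of_dominated_convergence (fun _ => T) ?_ ?_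
      (integrable_const _) ?_
    · filter_upwards [self_mem_nhdsWithin] with a (ha : 0 < a)
      simp_rw [intervalIntegral.integral_of_le hT.le]
      exact (hint a ha).abs.integral_prod_right.aestronglyMeasurable
    · filter_upwards [self_mem_nhdsWithin] with a (ha : 0 < a)
      filter_upwards [hpath] with ω H
      refine (intervalIntegral.norm_integral_le_of_norm_le_const (C := 1) fun t _ => ?_).trans_eq ?_
      · rw [Real.norm_eq_abs, abs_abs]
        exact H.abs_deriv_sub_deriv_le hb ha hx _
      · rw [sub_zero, abs_of_pos hT, one_mul]
    · filter_upwards [hpath, hlevel x hx] with ω H hq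
      exact H.tendsto_integral_abs hb hlim hx hq T hT
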